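/- Let $K\subset\mathbb R^2$ be a compact strictly convex set with non-empty interior whose boundary $\gamma$ is a smooth ($C^\infty$) simple closed curve with everywhere positive curvature $\kappa$. Let $p_K(\theta)=\max_{x\in K}\langle x,(\cos\theta,\sin\theta)\rangle$ be its support function, and parametrize $\gamma$ by the angle $\theta$ between the $x$-axis and the outward normal, $\gamma=(p_K\cos\theta-p_K'\sin\theta,\;p_K\sin\theta+p_K'\cos\theta)$. Let $L$ and $A$ be the perimeter and the area of $K$; $\rho(\theta)=1/\kappa(\theta)=p_K(\theta)+p_K''(\theta)$ the curvature radius of $\gamma$, with maximum $\rho_M$ and minimum $\rho_m$; $\rho_e$ and $\rho_i$ the circumradius and the inradius of $K$; $\beta(\theta)=\gamma(\theta)-\rho(\theta)(\cos\theta,\sin\theta)$ the locus of curvature centers, $\tilde A=\frac12\oint_\beta\beta_1\,d\beta_2-\beta_2\,d\beta_1$ its oriented area, and $\rho_\beta(\theta)=|p_K'(\theta)+p_K'''(\theta)|$ its curvature radius (the reciprocal of the absolute value of the curvature of $\beta$ where $\beta'\neq0$, and $0$ where $\beta'=0$). For real parameters $\alpha,\delta,\mu,\sigma,\eta,\lambda,\xi,\zeta$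 put $$W=\alpha\int_0^{2\pi}\rho^2\,d\theta+\delta L^2+\mu A+\sigma|\tilde A|+\eta\int_0^{2\pi}\rho_\beta^2\,d\theta+\lambda(\rho_e-\rho_i)^2+\xi(\rho_M-\rho_m)^2+\zeta\oint_\gamma\kappa^2\,ds,$$ $$D=6\pi\alpha-\pi\mu+4\pi\sigma+24\pi\eta+4\lambda+4\xi-12\pi\zeta .$$ Let $S(K)$ be the Steiner disk of $K$, that is, the disk with center $\frac1\pi\int_0^{2\pi}p_K(\theta)(\cos\theta,\sin\theta)\,d\theta$ and radius $\frac{L}{2\pi}$, and let $h_2(K,S(K))=\left(\int_0^{2\pi}|p_K(\theta)-p_{S(K)}(\theta)|^2\,d\theta\right)^{1/2}$. Consider the condition $$(\ast)\qquad \eta,\xi,\zeta\ge0,\quad\lambda\le0,\quad 2\alpha+4\pi\delta+\mu-4\zeta\ge0,\quad 2\alpha+\sigma-2\eta-4\zeta\ge0,\quad D>0 .$$ (i) If $(\ast)$ holds, then $$h_2(K,S(K))^2\le\frac{2\pi}{3D}\,W .\qquad(\ast\ast)$$ (ii) If $K$ is a disk, $D\ne0$, $2\alpha+4\pi\delta+\mu=0$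 and $\zeta=0$, then equality holds in $(\ast\ast)$. (iii) Conversely, if $(\ast)$ holds, $\lambda^2+\xi^2+\zeta^2>0$ and equality holds in $(\ast\ast)$, then $K$ is a disk. -/

import Mathlib

open scoped ContDiff

noncomputable section

namespace SteinerStability

/-- The Euclidean plane. -/
abbrev Plane : Type := EuclideanSpace ℝ (Fin 2)

/-- The determinant of two plane vectors. -/
def det2 (v w : Plane) : ℝ := v 0 * w 1 - v 1 * w 0

/-- `K` is a closed (bounded) strictly convex domain enclosed by a smooth curve: a compact strictly
convex set with interior points, whose boundary is a smooth simple closed curve with everywhere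
positive curvature (the curve is run through counterclockwise, so that positivity of the curvature
is positivity of `det2 c' c''`; in particular `c'` does not vanish). -/
structure IsSmoothStrictlyConvexDomain (K : Set Plane) : Prop where
  isCompact : IsCompact K
  strictConvex : StrictConvex ℝ K
  interior_nonempty : (interior K).Nonempty
  smooth_boundary : ∃ c : ℝ → Plane, ContDiff ℝ ∞ c ∧ Function.Periodic c (2 * Real.pi) ∧
    Set.InjOn c (Set.Ico 0 (2 * Real.pi)) ∧ (∀ t, 0 < det2 (deriv c t) (deriv (deriv c) t)) ∧
    Set.range c = frontier K

/-- `K` is a (closed, nondegenerate) disk. -/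
def IsDisk (K : Set Plane) : Prop := ∃ (x : Plane) (r : ℝ), 0 < r ∧ K = Metric.closedBall x r

/-! ### Plane curves defined on `[0, 2π]` -/

/-- The length `∮ ds`. -/
def curveLength (c : ℝ → Plane) : ℝ := ∫ t in (0 : ℝ)..(2 * Real.pi), ‖deriv c t‖

/-- The oriented area `½ ∮ c₁ dc₂ - c₂ dc₁`. -/
def orientedArea (c : ℝ → Plane) : ℝ :=
  1 / 2 * ∫ t in (0 : ℝ)..(2 * Real.pi), det2 (c t) (deriv c t)

/-- The signed curvature `(c₁' c₂'' - c₂' c₁'') / (c₁'² + c₂'²)^(3/2)` (at points with `c' ≠ 0`). -/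
def curvature (c : ℝ → Plane) (t : ℝ) : ℝ :=
  det2 (deriv c t) (deriv (deriv c) t) / ‖deriv c t‖ ^ 3

/-! ### The support function and the quantities derived from it -/

/-- The unit vector `(cos θ, sin θ)`. -/
def unitVec (θ : ℝ) : Plane := !₂[Real.cos θ, Real.sin θ]

/-- The support function `p_K(θ) = max_{x ∈ K} ⟨x, (cos θ, sin θ)⟩`. -/
def suppFun (K : Set Plane) (θ : ℝ) : ℝ := sSup ((fun x : Plane => inner ℝ x (unitVec θ)) '' K)

/-- The boundary curve `γ` of `K`, parametrized by the angle `θ` of the outward normal: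
`γ = (p cos θ - p' sin θ, p sin θ + p' cos θ)`. -/
def boundaryCurve (K : Set Plane) (θ : ℝ) : Plane :=
  !₂[suppFun K θ * Real.cos θ - deriv (suppFun K) θ * Real.sin θ,
    suppFun K θ * Real.sin θ + deriv (suppFun K) θ * Real.cos θ]

/-- The perimeter `L`. -/
def perimeter (K : Set Plane) : ℝ := curveLength (boundaryCurve K)

/-- The area `A`. -/
def area (K : Set Plane) : ℝ := (MeasureTheory.volume K).toReal

/-- The curvature `κ(θ)` of `γ`. -/
def kappa (K : Set Plane) (θ : ℝ) : ℝ := curvature (boundaryCurve K) θ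

/-- The curvature radius `ρ(θ) = 1 / κ(θ)` of `γ`. -/
def rho (K : Set Plane) (θ : ℝ) : ℝ := 1 / kappa K θ

/-- The maximal curvature radius `ρ_M`. -/
def rhoMax (K : Set Plane) : ℝ := sSup (Set.range (rho K))

/-- The minimal curvature radius `ρ_m`. -/
def rhoMin (K : Set Plane) : ℝ := sInf (Set.range (rho K))

/-- The integral `∮_γ κ² ds`. -/
def curvatureEnergy (K : Set Plane) : ℝ :=
  ∫ θ in (0 : ℝ)..(2 * Real.pi), kappa K θ ^ 2 * ‖deriv (boundaryCurve K) θ‖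

/-- The locus `β = γ + ρ N` of curvature centers, `N = -(cos θ, sin θ)` the inward unit normal. -/
def evolute (K : Set Plane) (θ : ℝ) : Plane := boundaryCurve K θ + rho K θ • (-unitVec θ)

/-- The oriented area `Ã` of the domain enclosed by `β`. -/
def evoluteArea (K : Set Plane) : ℝ := orientedArea (evolute K)

open Classical in
/-- The curvature radius `ρ_β(θ) = |1 / κ_β(θ)|` of `β`, with value `0` at the singular points
(`β' = 0`) of `β`; this is the function `|p' + p'''|`. -/
def rhoEvolute (K : Set Plane) (θ : ℝ) : ℝ :=
  if deriv (evolute K) θ = 0 then 0 else |1 / curvature (evolute K) θ|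

/-- The circumradius `ρ_e`: the radius of the smallest disk that contains `K`. -/
def circumradius (K : Set Plane) : ℝ :=
  sInf {r : ℝ | 0 ≤ r ∧ ∃ x : Plane, K ⊆ Metric.closedBall x r}

/-- The inradius `ρ_i`: the radius of a largest disk contained in `K`. -/
def inradius (K : Set Plane) : ℝ :=
  sSup {r : ℝ | 0 ≤ r ∧ ∃ x : Plane, Metric.closedBall x r ⊆ K}

/-- The functional `W`. -/
def W (K : Set Plane) (α δ μ σ η lam ξ ζ : ℝ) : ℝ :=
  α * (∫ θ in (0 : ℝ)..(2 * Real.pi), rho K θ ^ 2) + δ * perimeter K ^ 2 + μ * area K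
    + σ * |evoluteArea K| + η * (∫ θ in (0 : ℝ)..(2 * Real.pi), rhoEvolute K θ ^ 2)
    + lam * (circumradius K - inradius K) ^ 2 + ξ * (rhoMax K - rhoMin K) ^ 2
    + ζ * curvatureEnergy K

/-! ### The Steiner disk and the `L²` distance -/

/-- The Steiner point `(1/π) ∫ p_K(θ) (cos θ, sin θ) dθ`. -/
def steinerPoint (K : Set Plane) : Plane :=
  !₂[1 / Real.pi * ∫ θ in (0 : ℝ)..(2 * Real.pi), suppFun K θ * Real.cos θ,
    1 / Real.pi * ∫ θ in (0 : ℝ)..(2 * Real.pi), suppFun K θ * Real.sin θ]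

/-- The Steiner disk `S(K)`: the disk around the Steiner point with the perimeter of `K`. -/
def steinerDisk (K : Set Plane) : Set Plane :=
  Metric.closedBall (steinerPoint K) (perimeter K / (2 * Real.pi))

/-- The `L²` distance `h₂(K, K')` of the support functions. -/
def h2 (K K' : Set Plane) : ℝ :=
  Real.sqrt (∫ θ in (0 : ℝ)..(2 * Real.pi), |suppFun K θ - suppFun K' θ| ^ 2)

/-! ### Conditions on the parameters -/

/-- The number `6πα - πμ + 4πσ + 24πη + 4λ + 4ξ - 12πζ`. -/
def stabNumber (α μ σ η lam ξ ζ : ℝ) : ℝ :=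
  6 * Real.pi * α - Real.pi * μ + 4 * Real.pi * σ + 24 * Real.pi * η + 4 * lam + 4 * ξ
    - 12 * Real.pi * ζ

/-- The stability condition on the parameters. -/
structure StabCondition (α δ μ σ η lam ξ ζ : ℝ) : Prop where
  eta_nonneg : 0 ≤ η
  xi_nonneg : 0 ≤ ξ
  zeta_nonneg : 0 ≤ ζ
  lam_nonpos : lam ≤ 0
  first : 0 ≤ 2 * α + 4 * Real.pi * δ + μ - 4 * ζ
  second : 0 ≤ 2 * α + σ - 2 * η - 4 * ζ
  third : 0 < stabNumber α μ σ η lam ξ ζ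

/-- The constant `C = 2π / (3 (6πα - πμ + 4πσ + 24πη + 4λ + 4ξ - 12πζ))`. -/
def stabConst (α μ σ η lam ξ ζ : ℝ) : ℝ :=
  2 * Real.pi / (3 * stabNumber α μ σ η lam ξ ζ)

end SteinerStability

end

noncomputable section

namespace SteinerStability

open MeasureTheory Set

/-! ### Smooth `2π`-periodic functions -/

/-! Let `r` be the support function of `K` minus that of the Steiner disk (`deviation`). The choice
of center and radius makes `r` orthogonal to `1`, `cos` and `sin`, so only the harmonics of order `n
≥ 2` remain. Write `a`, `b`, `c`, `d` for the squared L² norms of `r`, `r'`, `r''`, `r'''`; then `a`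
is the squared distance to be bounded.

Up to multiples of `L²`, integration by parts turns `∫ρ²` into `a - 2b + c`, the area into `(a -
b)/2`, `|Ã|` into `(c - b)/2` and `∫ρ_β²` into `b - 2c + d`. Hence `W` can be regrouped (`W_eq`) as
`3D/(2π) · a` plus terms that the stability condition makes nonnegative. Three of these are governed
by the forms `b - 4a`, `c - 5b + 4a`, `d - c - 16b + 16a`, which act on the `n`-th harmonic as `n² -
4`, `(n² - 1)(n² - 4)`, `(n² - 1)(n⁴ - 16)`. The first is nonnegative by Wirtinger's inequality
(`four_mul_integral_sq_le`); the other two follow from it and complete squares. The term in `λ ≤ 0`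
needs Bonnesen's inequality `π(ρ_e - ρ_i)² ≤ 2(b - a)`, the one in `ξ` Popoviciu's inequality for
the curvature radius.

Bonnesen's inequality is again of Wirtinger type. Subtracting from the support function that of an
optimal circumscribed or inscribed disk leaves a function with a zero in each closed half circle,
since otherwise the disk could be improved by moving its center. Such a function has no larger L²
norm than its derivative.

Equality forces `b = 4a`. If `ζ > 0`, a positive multiple of `L²` is left over, which is impossible;
if `ξ > 0`, then also `b = a`, so `a = 0`. If `λ < 0`, Bonnesen's inequality must be an equality,
`π(ρ_e - ρ_i)² = 6a`; but `b = 4a` means `r'' = -4r`, and the annulus around the Steiner point then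
gives `π(ρ_e - ρ_i)² ≤ 4a`, so `a = 0`.

The formulas need a smooth support function, which the implicit function theorem supplies
(`contDiff_suppFun`), and the area formula, obtained by a change of variables (`area_eq`). -/

/-- Smooth functions on the circle, as `2π`-periodic functions on the line. -/
structure SmoothPeriodic (f : ℝ → ℝ) : Prop where
  smooth : ContDiff ℝ ∞ f
  periodic : Function.Periodic f (2 * Real.pi)

namespace SmoothPeriodic

variable {f g : ℝ → ℝ}

theorem continuous (hf : SmoothPeriodic f) : Continuous f := hf.smooth.continuous

theorem differentiable (hf : SmoothPeriodic f) : Differentiable ℝ f :=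
  hf.smooth.differentiable (by simp)

theorem hasDerivAt (hf : SmoothPeriodic f) (x : ℝ) : HasDerivAt f (deriv f x) x :=
  (hf.differentiable x).hasDerivAt

theorem deriv (hf : SmoothPeriodic f) : SmoothPeriodic (deriv f) where
  smooth := (contDiff_infty_iff_deriv.1 hf.smooth).2
  periodic x := by
    rw [← deriv_comp_add_const]
    congr 1
    exact funext hf.periodic

theorem add (hf : SmoothPeriodic f) (hg : SmoothPeriodic g) :
    SmoothPeriodic (fun x => f x + g x) :=
  ⟨hf.smooth.add hg.smooth, fun x => by simp only [hf.periodic x, hg.periodic x]⟩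

theorem sub (hf : SmoothPeriodic f) (hg : SmoothPeriodic g) :
    SmoothPeriodic (fun x => f x - g x) :=
  ⟨hf.smooth.sub hg.smooth, fun x => by simp only [hf.periodic x, hg.periodic x]⟩

theorem const_mul (hf : SmoothPeriodic f) (c : ℝ) : SmoothPeriodic (fun x => c * f x) :=
  ⟨contDiff_const.mul hf.smooth, fun x => by simp only [hf.periodic x]⟩

theorem mul (hf : SmoothPeriodic f) (hg : SmoothPeriodic g) :
    SmoothPeriodic (fun x => f x * g x) :=
  ⟨hf.smooth.mul hg.smooth, fun x => by simp only [hf.periodic x, hg.periodic x]⟩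

theorem const (c : ℝ) : SmoothPeriodic (fun _ => c) := ⟨contDiff_const, fun _ => rfl⟩

theorem cos : SmoothPeriodic Real.cos := ⟨Real.contDiff_cos, Real.cos_periodic⟩

theorem sin : SmoothPeriodic Real.sin := ⟨Real.contDiff_sin, Real.sin_periodic⟩

/-- Integration by parts on the circle. -/
theorem integral_deriv_mul (hf : SmoothPeriodic f) (hg : SmoothPeriodic g) :
    ∫ x in (0 : ℝ)..(2 * Real.pi), _root_.deriv f x * g x =
      -∫ x in (0 : ℝ)..(2 * Real.pi), f x * _root_.deriv g x := by
  have h := intervalIntegral.integral_mul_deriv_eq_deriv_mul (a := 0) (b := 2 * Real.pi)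
    (fun x _ => hf.hasDerivAt x) (fun x _ => hg.hasDerivAt x)
    (hf.deriv.continuous.intervalIntegrable _ _) (hg.deriv.continuous.intervalIntegrable _ _)
  have h1 := hf.periodic 0
  have h2 := hg.periodic 0
  rw [zero_add] at h1 h2
  rw [h, h1, h2]
  ring

theorem integral_deriv (hf : SmoothPeriodic f) :
    ∫ x in (0 : ℝ)..(2 * Real.pi), _root_.deriv f x = 0 := by
  have h := hf.integral_deriv_mul (const 1)
  simpa using h

theorem integral_deriv_deriv_mul (hf : SmoothPeriodic f) (hg : SmoothPeriodic g) :
    ∫ x in (0 : ℝ)..(2 * Real.pi), _root_.deriv (_root_.deriv f) x * g x =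
      ∫ x in (0 : ℝ)..(2 * Real.pi), f x * _root_.deriv (_root_.deriv g) x := by
  rw [hf.deriv.integral_deriv_mul hg, hf.integral_deriv_mul hg.deriv, neg_neg]

theorem eq_zero_of_integral_sq (hf : SmoothPeriodic f)
    (h : ∫ x in (0 : ℝ)..(2 * Real.pi), f x ^ 2 = 0) (x : ℝ) : f x = 0 := by
  by_contra hne
  obtain ⟨y, hy, hxy⟩ := hf.periodic.exists_mem_Ico₀ Real.two_pi_pos x
  have hpos : 0 < ∫ x in (0 : ℝ)..(2 * Real.pi), f x ^ 2 :=
    intervalIntegral.integral_pos Real.two_pi_pos (hf.continuous.pow 2).continuousOn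
      (fun _ _ => sq_nonneg _) ⟨y, Ico_subset_Icc_self hy, by rw [← hxy]; positivity⟩
  exact hpos.ne' h

end SmoothPeriodic

/-! ### Wirtinger inequalities -/

/-- With `T = tan (k (x - m))`, `m` the midpoint, `(f' + k f T)² = f'² - k² f² + (k f² T)'`, and the
last term integrates to zero. The strict bound `k < 1` keeps the poles of the tangent outside `[a,
b]` even when its length is `π`. -/
theorem sq_mul_integral_sq_le {f : ℝ → ℝ} (hf : ContDiff ℝ 1 f) {a b k : ℝ} (hab : a ≤ b)
    (hlen : b - a ≤ Real.pi) (ha : f a = 0) (hb : f b = 0) (hk0 : 0 ≤ k) (hk1 : k < 1) :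
    k ^ 2 * (∫ x in a..b, f x ^ 2) ≤ ∫ x in a..b, deriv f x ^ 2 := by
  have hpi := Real.pi_pos
  set m := (a + b) / 2 with hm
  have hcos : ∀ x ∈ uIcc a b, Real.cos (k * (x - m)) ≠ 0 := by
    intro x hx
    rw [uIcc_of_le hab] at hx
    refine (Real.cos_pos_of_mem_Ioo ⟨?_, ?_⟩).ne'
    · nlinarith [hx.1, hx.2]
    · nlinarith [hx.1, hx.2]
  have hd : ∀ x ∈ uIcc a b, HasDerivAt (fun y => f y ^ 2 * (k * Real.tan (k * (y - m))))
      (2 * f x * deriv f x * (k * Real.tan (k * (x - m)))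
        + f x ^ 2 * (k * (k * (1 + Real.tan (k * (x - m)) ^ 2)))) x := by
    intro x hx
    have h1 : HasDerivAt f (deriv f x) x := (hf.differentiable (by simp) x).hasDerivAt
    have h2 : HasDerivAt (fun y => k * (y - m)) k x := by
      simpa using ((hasDerivAt_id x).sub_const m).const_mul k
    have h3 := (Real.hasDerivAt_tan (hcos x hx)).comp x h2
    have h4 := (h1.pow 2).mul (h3.const_mul k)
    refine h4.congr_deriv ?_
    have := hcos x hx
    have h5 : 1 / Real.cos (k * (x - m)) ^ 2 = 1 + Real.tan (k * (x - m)) ^ 2 := by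
      rw [Real.tan_eq_sin_div_cos]
      field_simp
      rw [Real.cos_sq_add_sin_sq]
    simp only [Function.comp, h5, Pi.pow_apply]
    push_cast
    ring
  have hf' : Continuous (deriv f) := hf.continuous_deriv le_rfl
  have htan : ContinuousOn (fun x => Real.tan (k * (x - m))) (uIcc a b) := by
    intro x hx
    refine ContinuousAt.continuousWithinAt ?_
    exact ContinuousAt.comp (f := fun y => k * (y - m)) (Real.continuousAt_tan.2 (hcos x hx))
      (by fun_prop)
  have hfc := hf.continuous
  have hci : ContinuousOn (fun x => 2 * f x * deriv f x * (k * Real.tan (k * (x - m)))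
        + f x ^ 2 * (k * (k * (1 + Real.tan (k * (x - m)) ^ 2)))) (uIcc a b) := by
    fun_prop
  have hint := intervalIntegral.integral_eq_sub_of_hasDerivAt hd hci.intervalIntegrable
  rw [ha, hb] at hint
  have hnn : 0 ≤ ∫ x in a..b, (deriv f x + k * f x * Real.tan (k * (x - m))) ^ 2 :=
    intervalIntegral.integral_nonneg hab fun x _ => sq_nonneg _
  have hsplit : ∫ x in a..b, (deriv f x + k * f x * Real.tan (k * (x - m))) ^ 2 =
      (∫ x in a..b, deriv f x ^ 2) - k ^ 2 * (∫ x in a..b, f x ^ 2) +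
      ∫ x in a..b, (2 * f x * deriv f x * (k * Real.tan (k * (x - m)))
        + f x ^ 2 * (k * (k * (1 + Real.tan (k * (x - m)) ^ 2)))) := by
    rw [← intervalIntegral.integral_const_mul, ← intervalIntegral.integral_sub,
      ← intervalIntegral.integral_add]
    · refine intervalIntegral.integral_congr fun x _ => ?_
      ring
    · exact Continuous.intervalIntegrable (by fun_prop) _ _
    · exact hci.intervalIntegrable
    · exact Continuous.intervalIntegrable (by fun_prop) _ _
    · exact Continuous.intervalIntegrable (by fun_prop) _ _
  rw [hsplit, hint] at hnn
  linarith

/-- **Wirtinger's inequality** with Dirichlet boundary values on an interval of length at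
most `π`. -/
theorem integral_sq_le_integral_deriv_sq {f : ℝ → ℝ} (hf : ContDiff ℝ 1 f) {a b : ℝ}
    (hab : a ≤ b) (hlen : b - a ≤ Real.pi) (ha : f a = 0) (hb : f b = 0) :
    ∫ x in a..b, f x ^ 2 ≤ ∫ x in a..b, deriv f x ^ 2 := by
  -- The constant `1` is reached only in the limit `k → 1` from below.
  have hlim : Filter.Tendsto (fun k : ℝ => k ^ 2 * (∫ x in a..b, f x ^ 2))
      (nhdsWithin 1 (Iio 1)) (nhds (1 ^ 2 * (∫ x in a..b, f x ^ 2))) := by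
    refine Filter.Tendsto.mono_left ?_ nhdsWithin_le_nhds
    exact (by fun_prop : Continuous fun k : ℝ => k ^ 2 * (∫ x in a..b, f x ^ 2)).tendsto 1
  rw [one_pow, one_mul] at hlim
  refine le_of_tendsto hlim ?_
  have h0 : ∀ᶠ k : ℝ in nhdsWithin 1 (Iio 1), 0 < k :=
    nhdsWithin_le_nhds (lt_mem_nhds one_pos)
  filter_upwards [self_mem_nhdsWithin, h0] with k hk hk0
  exact sq_mul_integral_sq_le hf hab hlen ha hb hk0.le hk

/-- Wirtinger's inequality for a periodic function with a zero in each closed half-period. -/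
theorem integral_sq_le_of_zero_in_half_periods {f : ℝ → ℝ} (hf : SmoothPeriodic f)
    (hz : ∀ a, ∃ x ∈ Icc a (a + Real.pi), f x = 0) :
    ∫ x in (0 : ℝ)..(2 * Real.pi), f x ^ 2 ≤ ∫ x in (0 : ℝ)..(2 * Real.pi), deriv f x ^ 2 := by
  have hpi := Real.pi_pos
  obtain ⟨t, -, ht⟩ := hz 0
  have hfc := hf.continuous
  have hf'c := hf.deriv.continuous
  have hshift : ∀ g : ℝ → ℝ, Function.Periodic g (2 * Real.pi) →
      ∫ x in (0 : ℝ)..(2 * Real.pi), g x ^ 2 = ∫ x in t..(t + 2 * Real.pi), g x ^ 2 := by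
    intro g hg
    have h := Function.Periodic.intervalIntegral_add_eq (f := fun x => g x ^ 2)
      (T := 2 * Real.pi) (fun x => by simp only [hg x]) 0 t
    rw [← h, zero_add]
  rw [hshift f hf.periodic, hshift _ hf.deriv.periodic]
  have ht2 : f (t + 2 * Real.pi) = 0 := by rw [hf.periodic, ht]
  have hclosed : IsClosed {x | f x = 0} := isClosed_eq hfc continuous_const
  -- the last zero of the first half-period and the first zero of the second one
  have hc1 : IsCompact (Icc t (t + Real.pi) ∩ {x | f x = 0}) := isCompact_Icc.inter_right hclosed
  have hc2 : IsCompact (Icc (t + Real.pi) (t + 2 * Real.pi) ∩ {x | f x = 0}) :=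
    isCompact_Icc.inter_right hclosed
  obtain ⟨u, ⟨⟨hu1, hu2⟩, hu0⟩, hu⟩ := hc1.exists_isGreatest ⟨t, ⟨le_rfl, by linarith⟩, ht⟩
  obtain ⟨v, ⟨⟨hv1, hv2⟩, hv0⟩, hv⟩ :=
    hc2.exists_isLeast ⟨t + 2 * Real.pi, ⟨by linarith, le_rfl⟩, ht2⟩
  have huv : v - u ≤ Real.pi := by
    by_contra! hlt
    -- The half-period centered at the midpoint of `u` and `v` lies strictly between them, where no
    -- zero is left.
    obtain ⟨x, ⟨hx1, hx2⟩, hx0⟩ := hz ((u + v - Real.pi) / 2)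
    rcases le_total x (t + Real.pi) with hx | hx
    · have := hu ⟨⟨by linarith, hx⟩, hx0⟩
      linarith
    · have := hv ⟨⟨hx, by linarith⟩, hx0⟩
      linarith
  have h1 : ContDiff ℝ 1 f := hf.smooth.of_le (by simp)
  have e1 := integral_sq_le_integral_deriv_sq h1 hu1 (by linarith) ht hu0
  have e2 := integral_sq_le_integral_deriv_sq h1 (hu2.trans hv1) huv hu0 hv0
  have e3 := integral_sq_le_integral_deriv_sq h1 hv2 (by linarith) hv0 ht2
  have hadd : ∀ g : ℝ → ℝ, Continuous g → ∫ x in t..(t + 2 * Real.pi), g x ^ 2 =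
      (∫ x in t..u, g x ^ 2) + (∫ x in u..v, g x ^ 2) + ∫ x in v..(t + 2 * Real.pi), g x ^ 2 := by
    intro g hg
    have hi : ∀ a b, IntervalIntegrable (fun x => g x ^ 2) volume a b := fun a b =>
      (hg.pow 2).intervalIntegrable a b
    rw [intervalIntegral.integral_add_adjacent_intervals (hi _ _) (hi _ _),
      intervalIntegral.integral_add_adjacent_intervals (hi _ _) (hi _ _)]
  rw [hadd f hfc, hadd _ hf'c]
  linarith

theorem fourierCoeffOn_one_or_neg_one {f : ℝ → ℝ} (hf : Continuous f)
    (hcos : ∫ x in (0 : ℝ)..(2 * Real.pi), f x * Real.cos x = 0)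
    (hsin : ∫ x in (0 : ℝ)..(2 * Real.pi), f x * Real.sin x = 0) {n : ℤ}
    (hn : n = 1 ∨ n = -1) :
    fourierCoeffOn Real.two_pi_pos (fun x => (f x : ℂ)) n = 0 := by
  rw [fourierCoeffOn_eq_integral]
  have hn' : (n : ℝ) ^ 2 = 1 := by rcases hn with rfl | rfl <;> simp
  have h : ∀ x : ℝ, fourier (-n) (x : AddCircle (2 * Real.pi - 0)) • (f x : ℂ) =
      ((f x * Real.cos x : ℝ) : ℂ) - (n * Complex.I) * ((f x * Real.sin x : ℝ) : ℂ) := by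
    intro x
    rw [fourier_coe_apply]
    have hpi : (Real.pi : ℂ) ≠ 0 := by exact_mod_cast Real.pi_ne_zero
    have e : 2 * (Real.pi : ℂ) * Complex.I * ((-n : ℤ) : ℂ) * (x : ℂ) /
        ((2 * Real.pi - 0 : ℝ) : ℂ) = (((-n * x : ℝ)) : ℂ) * Complex.I := by
      push_cast
      field_simp
      ring
    rw [e, Complex.exp_mul_I]
    rcases hn with rfl | rfl
    · simp
      ring
    · simp
      ring
  simp_rw [h]
  rw [intervalIntegral.integral_sub, intervalIntegral.integral_const_mul,
    intervalIntegral.integral_ofReal, intervalIntegral.integral_ofReal, hcos, hsin]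
  · simp
  · exact Continuous.intervalIntegrable (by fun_prop) _ _
  · exact Continuous.intervalIntegrable (by fun_prop) _ _

/-- **Wirtinger's inequality** for periodic functions orthogonal to the harmonics of order
`0` and `1`. -/
theorem four_mul_integral_sq_le {f : ℝ → ℝ} (hf : SmoothPeriodic f)
    (h0 : ∫ x in (0 : ℝ)..(2 * Real.pi), f x = 0)
    (hcos : ∫ x in (0 : ℝ)..(2 * Real.pi), f x * Real.cos x = 0)
    (hsin : ∫ x in (0 : ℝ)..(2 * Real.pi), f x * Real.sin x = 0) :
    4 * ∫ x in (0 : ℝ)..(2 * Real.pi), f x ^ 2 ≤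
      ∫ x in (0 : ℝ)..(2 * Real.pi), deriv f x ^ 2 := by
  have hL2 : ∀ g : ℝ → ℝ, Continuous g →
      MemLp (fun x => (g x : ℂ)) 2 (volume.restrict (Ioc 0 (2 * Real.pi))) := by
    intro g hg
    have hc : Continuous fun x => (g x : ℂ) := by fun_prop
    obtain ⟨C, hC⟩ := isCompact_Icc.exists_bound_of_continuousOn
      (s := Icc 0 (2 * Real.pi)) hc.continuousOn
    exact MemLp.of_bound hc.aestronglyMeasurable C
      (ae_restrict_of_forall_mem measurableSet_Ioc fun x hx => hC x (Ioc_subset_Icc_self hx))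
  -- Parseval on both sides reduces the claim to single coefficients: those of order `0` and `±1`
  -- vanish, and the others gain a factor `n² ≥ 4` under differentiation.
  have P1 := hasSum_sq_fourierCoeffOn Real.two_pi_pos (hL2 f hf.continuous)
  have P2 := hasSum_sq_fourierCoeffOn Real.two_pi_pos (hL2 _ hf.deriv.continuous)
  have hle := hasSum_le (fun n => ?_) (P1.mul_left 4) P2
  · simp only [Complex.norm_real, Real.norm_eq_abs, sq_abs, sub_zero, smul_eq_mul] at hle
    have hpos : 0 < (2 * Real.pi)⁻¹ := inv_pos.2 Real.two_pi_pos
    nlinarith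
  · by_cases hn0 : n = 0
    · subst hn0
      have : fourierCoeffOn Real.two_pi_pos (fun x => (f x : ℂ)) 0 = 0 := by
        rw [fourierCoeffOn_eq_integral]
        simp [intervalIntegral.integral_ofReal, h0]
      rw [this]
      simp
    by_cases hn1 : n = 1 ∨ n = -1
    · rw [fourierCoeffOn_one_or_neg_one hf.continuous hcos hsin hn1]
      simp
    have hder := fourierCoeffOn_of_hasDerivAt Real.two_pi_pos (n := n)
      (f := fun x => (f x : ℂ)) (f' := fun x => ((deriv f x : ℝ) : ℂ)) hn0
      (fun x _ => (hf.hasDerivAt x).ofReal_comp)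
      (Continuous.intervalIntegrable (by have := hf.deriv.continuous; fun_prop) _ _)
    have hper := hf.periodic 0
    rw [zero_add] at hper
    rw [hper, sub_self, mul_zero, zero_sub] at hder
    rw [hder]
    have hnorm : ‖(1 : ℂ) / (-2 * Real.pi * Complex.I * n) *
        -(((2 * Real.pi : ℝ) - (0 : ℝ) : ℂ) *
          fourierCoeffOn Real.two_pi_pos (fun x => ((deriv f x : ℝ) : ℂ)) n)‖ =
        |(n : ℝ)|⁻¹ * ‖fourierCoeffOn Real.two_pi_pos (fun x => ((deriv f x : ℝ) : ℂ)) n‖ := by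
      simp [abs_of_pos Real.pi_pos]
      field_simp
    rw [hnorm, mul_pow, inv_pow, sq_abs]
    have hn2 : (4 : ℝ) ≤ (n : ℝ) ^ 2 := by
      have : (4 : ℤ) ≤ n ^ 2 := by
        have : 2 ≤ n ∨ n ≤ -2 := by omega
        rcases this with h | h <;> nlinarith
      exact_mod_cast this
    rw [← mul_assoc]
    refine mul_le_of_le_one_left (sq_nonneg _) ?_
    rw [← div_eq_mul_inv, div_le_one (by linarith)]
    exact hn2

/-- The equality case of `four_mul_integral_sq_le`. -/
theorem deriv_deriv_eq_of_four_mul_integral_sq_eq {f : ℝ → ℝ} (hf : SmoothPeriodic f)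
    (h0 : ∫ x in (0 : ℝ)..(2 * Real.pi), f x = 0)
    (hcos : ∫ x in (0 : ℝ)..(2 * Real.pi), f x * Real.cos x = 0)
    (hsin : ∫ x in (0 : ℝ)..(2 * Real.pi), f x * Real.sin x = 0)
    (heq : 4 * ∫ x in (0 : ℝ)..(2 * Real.pi), f x ^ 2 =
      ∫ x in (0 : ℝ)..(2 * Real.pi), deriv f x ^ 2) (x : ℝ) :
    deriv (deriv f) x = -4 * f x := by
  -- Variational argument: `f` minimizes the nonnegative form `‖g'‖² - 4‖g‖²`, and `v` is, up to a
  -- factor, minus its gradient at `f`. The direction is admissible because `1`, `cos`, `sin` are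
  -- eigenfunctions of the second derivative.
  set v : ℝ → ℝ := fun y => deriv (deriv f) y + 4 * f y with hv
  have hvS : SmoothPeriodic v := hf.deriv.deriv.add (hf.const_mul 4)
  have hfc := hf.continuous
  have hf'c := hf.deriv.continuous
  have hf''c := hf.deriv.deriv.continuous
  have hvc := hvS.continuous
  have hv'c := hvS.deriv.continuous
  have hint : ∀ g : ℝ → ℝ, Continuous g → IntervalIntegrable g volume 0 (2 * Real.pi) :=
    fun g hg => hg.intervalIntegrable _ _
  have orth : ∀ g : ℝ → ℝ, SmoothPeriodic g → ∀ c : ℝ, (∀ y, deriv (deriv g) y = c * g y) →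
      ∫ y in (0 : ℝ)..(2 * Real.pi), f y * g y = 0 →
      ∫ y in (0 : ℝ)..(2 * Real.pi), v y * g y = 0 := by
    intro g hg c hgc hfg
    have hgcont := hg.continuous
    have h1 := hf.integral_deriv_deriv_mul hg
    simp_rw [hgc] at h1
    have h2 : ∫ y in (0 : ℝ)..(2 * Real.pi), f y * (c * g y) = 0 := by
      have : ∀ y, f y * (c * g y) = c * (f y * g y) := fun y => by ring
      simp_rw [this]
      rw [intervalIntegral.integral_const_mul, hfg, mul_zero]
    have h3 : ∀ y, v y * g y = deriv (deriv f) y * g y + 4 * (f y * g y) := fun y => by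
      simp only [hv]; ring
    simp_rw [h3]
    rw [intervalIntegral.integral_add (hint _ (by fun_prop)) (hint _ (by fun_prop)), h1, h2,
      intervalIntegral.integral_const_mul, hfg]
    simp
  have v0 : ∫ y in (0 : ℝ)..(2 * Real.pi), v y = 0 := by
    simpa using orth _ (SmoothPeriodic.const 1) 0 (fun y => by simp) (by simpa using h0)
  have vc := orth _ SmoothPeriodic.cos (-1) (fun y => by simp) hcos
  have vs := orth _ SmoothPeriodic.sin (-1) (fun y => by simp) hsin
  -- the quadratic form along the line `f + ε v`
  have hline : ∀ ε : ℝ, 0 ≤ ε ^ 2 * ((∫ y in (0 : ℝ)..(2 * Real.pi), deriv v y ^ 2) -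
      4 * ∫ y in (0 : ℝ)..(2 * Real.pi), v y ^ 2) -
      2 * ε * ∫ y in (0 : ℝ)..(2 * Real.pi), v y ^ 2 := by
    intro ε
    have hw : SmoothPeriodic (fun y => f y + ε * v y) := hf.add (hvS.const_mul ε)
    have hadd0 : ∀ g h : ℝ → ℝ, Continuous g → Continuous h →
        ∫ y in (0 : ℝ)..(2 * Real.pi), g y = 0 → ∫ y in (0 : ℝ)..(2 * Real.pi), h y = 0 →
        ∫ y in (0 : ℝ)..(2 * Real.pi), (g y + ε * h y) = 0 := by
      intro g h hg hh h1 h2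
      rw [intervalIntegral.integral_add (hint _ hg) (hint _ (by fun_prop)),
        intervalIntegral.integral_const_mul, h1, h2]
      simp
    have key := four_mul_integral_sq_le hw (hadd0 _ _ hfc hvc h0 v0)
      (by
        have := hadd0 (fun y => f y * Real.cos y) (fun y => v y * Real.cos y) (by fun_prop)
          (by fun_prop) hcos vc
        refine Eq.trans (intervalIntegral.integral_congr fun y _ => ?_) this
        ring)
      (by
        have := hadd0 (fun y => f y * Real.sin y) (fun y => v y * Real.sin y) (by fun_prop)
          (by fun_prop) hsin vs
        refine Eq.trans (intervalIntegral.integral_congr fun y _ => ?_) this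
        ring)
    have hd : ∀ y, deriv (fun y => f y + ε * v y) y = deriv f y + ε * deriv v y := fun y =>
      ((hf.hasDerivAt y).add ((hvS.hasDerivAt y).const_mul ε)).deriv
    simp_rw [hd] at key
    have hquad : ∀ g h : ℝ → ℝ, Continuous g → Continuous h →
        ∫ y in (0 : ℝ)..(2 * Real.pi), (g y + ε * h y) ^ 2 =
        (∫ y in (0 : ℝ)..(2 * Real.pi), g y ^ 2) +
        2 * ε * (∫ y in (0 : ℝ)..(2 * Real.pi), g y * h y) +
        ε ^ 2 * ∫ y in (0 : ℝ)..(2 * Real.pi), h y ^ 2 := by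
      intro g h hg hh
      rw [← intervalIntegral.integral_const_mul, ← intervalIntegral.integral_const_mul,
        ← intervalIntegral.integral_add (hint _ (by fun_prop)) (hint _ (by fun_prop)),
        ← intervalIntegral.integral_add (hint _ (by fun_prop)) (hint _ (by fun_prop))]
      exact intervalIntegral.integral_congr fun y _ => by ring
    rw [hquad _ _ hfc hvc, hquad _ _ hf'c hv'c] at key
    have hB : ∫ y in (0 : ℝ)..(2 * Real.pi), deriv f y * deriv v y =
        4 * (∫ y in (0 : ℝ)..(2 * Real.pi), f y * v y) -
          ∫ y in (0 : ℝ)..(2 * Real.pi), v y ^ 2 := by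
      have := hf.deriv.integral_deriv_mul hvS
      rw [← neg_eq_iff_eq_neg] at this
      rw [← this, ← intervalIntegral.integral_const_mul, ← intervalIntegral.integral_neg,
        ← intervalIntegral.integral_sub (hint _ (by fun_prop)) (hint _ (by fun_prop))]
      refine intervalIntegral.integral_congr fun y _ => ?_
      simp only [hv]
      ring
    rw [hB, ← heq] at key
    nlinarith
  have hV0 : ∫ y in (0 : ℝ)..(2 * Real.pi), v y ^ 2 = 0 := by
    set V := ∫ y in (0 : ℝ)..(2 * Real.pi), v y ^ 2
    set Q := ∫ y in (0 : ℝ)..(2 * Real.pi), deriv v y ^ 2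
    have hV : 0 ≤ V :=
      intervalIntegral.integral_nonneg Real.two_pi_pos.le fun _ _ => sq_nonneg _
    have hQ : 0 ≤ Q :=
      intervalIntegral.integral_nonneg Real.two_pi_pos.le fun _ _ => sq_nonneg _
    -- The form along the line is `ε²(Q - 4V) - 2εV`; a small positive `ε` makes it negative unless
    -- `V = 0`, and `Q + 1` serves as a nonzero denominator.
    have h := hline (V / (Q + 1))
    have e : (V / (Q + 1)) ^ 2 * (Q - 4 * V) - 2 * (V / (Q + 1)) * V =
        V ^ 2 * (-Q - 4 * V - 2) / (Q + 1) ^ 2 := by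
      field_simp
      ring
    rw [e, le_div_iff₀ (by positivity), zero_mul] at h
    have : V ^ 2 ≤ 0 := by nlinarith [mul_nonneg (sq_nonneg V) hQ, mul_nonneg (sq_nonneg V) hV]
    exact pow_eq_zero_iff two_ne_zero |>.1 (le_antisymm this (sq_nonneg V))
  have := hvS.eq_zero_of_integral_sq hV0 x
  simp only [hv] at this
  linarith

/-! ### The plane and the unit vectors -/

theorem inner_plane (x y : Plane) : inner ℝ x y = x 0 * y 0 + x 1 * y 1 := by
  rw [PiLp.inner_apply, Fin.sum_univ_two]
  simp [mul_comm]

@[simp] theorem unitVec_zero (θ : ℝ) : unitVec θ 0 = Real.cos θ := by simp [unitVec]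

@[simp] theorem unitVec_one (θ : ℝ) : unitVec θ 1 = Real.sin θ := by simp [unitVec]

theorem inner_unitVec (x : Plane) (θ : ℝ) :
    inner ℝ x (unitVec θ) = x 0 * Real.cos θ + x 1 * Real.sin θ := by
  simp [inner_plane]

@[simp] theorem norm_unitVec (θ : ℝ) : ‖unitVec θ‖ = 1 := by
  simp [EuclideanSpace.norm_eq]

theorem inner_unitVec_self (θ : ℝ) : inner ℝ (unitVec θ) (unitVec θ) = (1 : ℝ) := by
  simp

theorem unitVec_periodic : Function.Periodic unitVec (2 * Real.pi) := fun θ => by simp [unitVec]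

theorem contDiff_unitVec : ContDiff ℝ ∞ unitVec := by
  refine contDiff_euclidean.2 fun i => ?_
  fin_cases i
  · simpa using Real.contDiff_cos
  · simpa using Real.contDiff_sin

theorem exists_eq_norm_smul_unitVec (v : Plane) : ∃ θ, v = ‖v‖ • unitVec θ := by
  set z : ℂ := ⟨v 0, v 1⟩ with hz
  have hn : ‖z‖ = ‖v‖ := by
    rw [EuclideanSpace.norm_eq, Complex.norm_def, Complex.normSq_apply]
    simp [hz, Fin.sum_univ_two, sq]
  refine ⟨z.arg, ?_⟩
  ext i
  fin_cases i
  · have h := Complex.norm_mul_cos_arg z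
    rw [hn] at h
    simpa using h.symm
  · have h := Complex.norm_mul_sin_arg z
    rw [hn] at h
    simpa using h.symm

theorem smoothPeriodic_inner_unitVec (x : Plane) :
    SmoothPeriodic (fun θ => inner ℝ x (unitVec θ)) := by
  simp_rw [inner_unitVec]
  exact (SmoothPeriodic.cos.const_mul _).add (SmoothPeriodic.sin.const_mul _)

theorem hasDerivAt_inner_unitVec (x : Plane) (θ : ℝ) :
    HasDerivAt (fun θ => inner ℝ x (unitVec θ))
      (-(x 0) * Real.sin θ + x 1 * Real.cos θ) θ := by
  simp_rw [inner_unitVec]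
  convert! ((Real.hasDerivAt_cos θ).const_mul (x 0)).add ((Real.hasDerivAt_sin θ).const_mul (x 1))
    using 1
  ring

theorem deriv_deriv_inner_unitVec (x : Plane) (θ : ℝ) :
    deriv (deriv fun θ => inner ℝ x (unitVec θ)) θ = -inner ℝ x (unitVec θ) := by
  have h : (deriv fun θ => inner ℝ x (unitVec θ)) =
      fun θ => -(x 0) * Real.sin θ + x 1 * Real.cos θ :=
    funext fun θ => (hasDerivAt_inner_unitVec x θ).deriv
  rw [h, inner_unitVec]
  refine HasDerivAt.deriv ?_
  convert! ((Real.hasDerivAt_sin θ).const_mul (-(x 0))).add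
    ((Real.hasDerivAt_cos θ).const_mul (x 1)) using 1
  ring

/-! ### Support functions -/

section suppFun

variable {K : Set Plane}

theorem suppFun_periodic (K : Set Plane) : Function.Periodic (suppFun K) (2 * Real.pi) :=
  fun θ => by simp only [suppFun, unitVec_periodic θ]

theorem bddAbove_inner_image (hK : IsCompact K) (v : Plane) :
    BddAbove ((fun x : Plane => inner ℝ x v) '' K) :=
  hK.bddAbove_image (by fun_prop)

theorem inner_le_suppFun (hK : IsCompact K) {x : Plane} (hx : x ∈ K) (θ : ℝ) :
    inner ℝ x (unitVec θ) ≤ suppFun K θ :=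
  le_csSup (bddAbove_inner_image hK _) (mem_image_of_mem _ hx)

theorem suppFun_le (hne : K.Nonempty) {θ M : ℝ} (h : ∀ x ∈ K, inner ℝ x (unitVec θ) ≤ M) :
    suppFun K θ ≤ M :=
  csSup_le (hne.image _) (by rintro _ ⟨x, hx, rfl⟩; exact h x hx)

theorem exists_inner_eq_suppFun (hK : IsCompact K) (hne : K.Nonempty) (θ : ℝ) :
    ∃ x ∈ K, inner ℝ x (unitVec θ) = suppFun K θ := by
  obtain ⟨x, hx, h⟩ := hK.exists_sSup_image_eq hne
    (f := fun x : Plane => inner ℝ x (unitVec θ)) (by fun_prop)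
  exact ⟨x, hx, h.symm⟩

/-- A point lies in a compact convex set if no support line separates it. -/
theorem mem_of_forall_inner_le_suppFun (hK : IsCompact K) (hc : Convex ℝ K) (hne : K.Nonempty)
    {y : Plane} (h : ∀ θ, inner ℝ y (unitVec θ) ≤ suppFun K θ) : y ∈ K := by
  by_contra hy
  obtain ⟨f, u, hf, hu⟩ := geometric_hahn_banach_closed_point hc hK.isClosed hy
  set v := (InnerProductSpace.toDual ℝ Plane).symm f with hv
  have hfv : ∀ x, f x = inner ℝ x v := fun x => by
    rw [real_inner_comm, hv, InnerProductSpace.toDual_symm_apply]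
  obtain ⟨θ, hθ⟩ := exists_eq_norm_smul_unitVec v
  obtain ⟨x, hx, hxθ⟩ := exists_inner_eq_suppFun hK hne θ
  have h1 := (hf x hx).trans hu
  rw [hfv, hfv, hθ, inner_smul_right, inner_smul_right, hxθ] at h1
  exact absurd (mul_le_mul_of_nonneg_left (h θ) (norm_nonneg v)) (not_le.2 h1)

theorem subset_closedBall_iff (hK : IsCompact K) (hne : K.Nonempty) (x : Plane) (r : ℝ) :
    K ⊆ Metric.closedBall x r ↔ ∀ θ, suppFun K θ ≤ inner ℝ x (unitVec θ) + r := by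
  constructor
  · intro h θ
    refine suppFun_le hne fun y hy => ?_
    have h1 := h hy
    rw [mem_closedBall_iff_norm] at h1
    have h2 := real_inner_le_norm (y - x) (unitVec θ)
    rw [norm_unitVec, mul_one, inner_sub_left] at h2
    linarith
  · intro h y hy
    rw [mem_closedBall_iff_norm]
    obtain ⟨θ, hθ⟩ := exists_eq_norm_smul_unitVec (y - x)
    have h1 := (inner_le_suppFun hK hy θ).trans (h θ)
    have h2 : inner ℝ (y - x) (unitVec θ) = ‖y - x‖ := by
      nth_rewrite 1 [hθ]
      rw [inner_smul_left, inner_unitVec_self]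
      simp
    rw [inner_sub_left] at h2
    linarith

theorem add_smul_unitVec_mem_closedBall (x : Plane) {r : ℝ} (hr : 0 ≤ r) (θ : ℝ) :
    x + r • unitVec θ ∈ Metric.closedBall x r := by
  simp [norm_smul, abs_of_nonneg hr]

theorem closedBall_subset_iff (hK : IsCompact K) (hc : Convex ℝ K) (hne : K.Nonempty)
    (x : Plane) {r : ℝ} (hr : 0 ≤ r) :
    Metric.closedBall x r ⊆ K ↔ ∀ θ, inner ℝ x (unitVec θ) + r ≤ suppFun K θ := by
  constructor
  · intro h θ
    have h1 := inner_le_suppFun hK (h (add_smul_unitVec_mem_closedBall x hr θ)) θ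
    rwa [inner_add_left, inner_smul_left, inner_unitVec_self, mul_one] at h1
  · intro h y hy
    refine mem_of_forall_inner_le_suppFun hK hc hne fun θ => le_trans ?_ (h θ)
    rw [mem_closedBall_iff_norm] at hy
    have h2 := real_inner_le_norm (y - x) (unitVec θ)
    rw [norm_unitVec, mul_one, inner_sub_left] at h2
    linarith

theorem suppFun_closedBall (x : Plane) {r : ℝ} (hr : 0 ≤ r) (θ : ℝ) :
    suppFun (Metric.closedBall x r) θ = inner ℝ x (unitVec θ) + r := by
  have hK : IsCompact (Metric.closedBall x r) := isCompact_closedBall x r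
  have hne : (Metric.closedBall x r).Nonempty := Metric.nonempty_closedBall.2 hr
  exact le_antisymm ((subset_closedBall_iff hK hne x r).1 Subset.rfl θ)
    ((closedBall_subset_iff hK (convex_closedBall x r) hne x hr).1 Subset.rfl θ)

/-- The unit vectors at `θ + h` and `θ - h` add up to `2 cos h` times the one at `θ`; a support
point for `θ` is tested against both. This is convexity in the form that yields `p + p'' ≥ 0`. -/
theorem two_mul_cos_mul_suppFun_le (hK : IsCompact K) (hne : K.Nonempty) (θ h : ℝ) :
    2 * Real.cos h * suppFun K θ ≤ suppFun K (θ + h) + suppFun K (θ - h) := by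
  obtain ⟨x, hx, hxθ⟩ := exists_inner_eq_suppFun hK hne θ
  have h1 := inner_le_suppFun hK hx (θ + h)
  have h2 := inner_le_suppFun hK hx (θ - h)
  rw [inner_unitVec] at h1 h2 hxθ
  rw [Real.cos_add, Real.sin_add] at h1
  rw [Real.cos_sub, Real.sin_sub] at h2
  rw [← hxθ]
  linarith

/-- The width is positive in each direction. -/
theorem suppFun_add_suppFun_pi_pos (hK : IsCompact K) (hint : (interior K).Nonempty) (θ : ℝ) :
    0 < suppFun K θ + suppFun K (θ + Real.pi) := by
  obtain ⟨z, hz⟩ := hint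
  obtain ⟨r, hr, hb⟩ := Metric.nhds_basis_closedBall.mem_iff.1 (mem_interior_iff_mem_nhds.1 hz)
  have h1 := inner_le_suppFun hK (hb (add_smul_unitVec_mem_closedBall z hr.le θ)) θ
  have h2 := inner_le_suppFun hK (hb (Metric.mem_closedBall_self hr.le)) (θ + Real.pi)
  rw [inner_add_left, inner_smul_left, inner_unitVec_self, mul_one] at h1
  have h3 : inner ℝ z (unitVec (θ + Real.pi)) = -inner ℝ z (unitVec θ) := by
    simp [inner_unitVec]
    ring
  rw [h3] at h2
  simp only [conj_trivial] at h1
  linarith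

theorem inner_lt_suppFun_of_mem_interior (hK : IsCompact K) {z : Plane} (hz : z ∈ interior K)
    (θ : ℝ) : inner ℝ z (unitVec θ) < suppFun K θ := by
  obtain ⟨r, hr, hb⟩ := Metric.nhds_basis_closedBall.mem_iff.1 (mem_interior_iff_mem_nhds.1 hz)
  have h1 := inner_le_suppFun hK (hb (add_smul_unitVec_mem_closedBall z hr.le θ)) θ
  rw [inner_add_left, inner_smul_left, inner_unitVec_self, mul_one] at h1
  simp only [conj_trivial] at h1
  linarith

theorem mem_frontier_of_inner_eq_suppFun (hK : IsCompact K) {x : Plane} (hx : x ∈ K) {θ : ℝ}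
    (h : inner ℝ x (unitVec θ) = suppFun K θ) : x ∈ frontier K :=
  ⟨subset_closure hx, fun hi => (inner_lt_suppFun_of_mem_interior hK hi θ).ne h⟩

/-- A functional separating `x` from the interior is nonzero because the interior is nonempty, and
its bound extends to `K`, which lies in the closure of the interior. -/
theorem exists_inner_eq_suppFun_of_mem_frontier (hK : IsCompact K) (hc : Convex ℝ K)
    {x : Plane} (hx : x ∈ frontier K) (hint : (interior K).Nonempty) :
    ∃ θ, inner ℝ x (unitVec θ) = suppFun K θ := by
  have hxK : x ∈ K := hK.isClosed.frontier_subset hx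
  obtain ⟨f, hf⟩ := geometric_hahn_banach_open_point hc.interior isOpen_interior hx.2
  set v := (InnerProductSpace.toDual ℝ Plane).symm f with hv
  have hfv : ∀ x, f x = inner ℝ x v := fun x => by
    rw [real_inner_comm, hv, InnerProductSpace.toDual_symm_apply]
  obtain ⟨θ, hθ⟩ := exists_eq_norm_smul_unitVec v
  refine ⟨θ, le_antisymm (inner_le_suppFun hK hxK θ) ?_⟩
  have hclos : ∀ y ∈ K, f y ≤ f x := by
    intro y hy
    have hy' : y ∈ closure (interior K) := by
      rw [hc.closure_interior_eq_closure_of_nonempty_interior hint]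
      exact subset_closure hy
    exact closure_minimal (fun z hz => (hf z hz).le) (isClosed_le f.continuous continuous_const) hy'
  obtain ⟨z, hz⟩ := hint
  have hvpos : 0 < ‖v‖ := by
    rw [norm_pos_iff]
    intro h0
    have := hf z hz
    rw [hfv, hfv, h0] at this
    simp at this
  refine suppFun_le ⟨x, hxK⟩ fun y hy => ?_
  have h1 := hclos y hy
  rw [hfv, hfv, hθ, inner_smul_right, inner_smul_right] at h1
  exact le_of_mul_le_mul_left h1 hvpos

end suppFun

/-! ### Smoothness of the support function -/

theorem eq_of_inner_eq_suppFun {K : Set Plane} (hK : IsCompact K) (hsc : StrictConvex ℝ K)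
    {x y : Plane} {θ : ℝ} (hx : x ∈ K) (hy : y ∈ K) (hxθ : inner ℝ x (unitVec θ) = suppFun K θ)
    (hyθ : inner ℝ y (unitVec θ) = suppFun K θ) : x = y := by
  by_contra hne
  have hmid := hsc hx hy hne (a := 1 / 2) (b := 1 / 2) (by norm_num) (by norm_num) (by norm_num)
  have h := inner_lt_suppFun_of_mem_interior hK hmid θ
  rw [inner_add_left, inner_smul_left, inner_smul_left, hxθ, hyθ] at h
  simp only [conj_trivial] at h
  linarith

theorem eq_of_periodic_of_injOn {c : ℝ → Plane} (hper : Function.Periodic c (2 * Real.pi))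
    (hinj : InjOn c (Ico 0 (2 * Real.pi))) {s t : ℝ} (h : c s = c t) (hst : |s - t| ≤ Real.pi) :
    s = t := by
  have hp := Real.two_pi_pos
  have hmod : ∀ r, c (toIcoMod hp 0 r) = c r := fun r => hper.sub_zsmul_eq _
  have hmem : ∀ r, toIcoMod hp 0 r ∈ Ico 0 (2 * Real.pi) := fun r => by
    simpa using toIcoMod_mem_Ico hp 0 r
  have h1 := hinj (hmem s) (hmem t) (by rw [hmod, hmod, h])
  obtain ⟨n, hn⟩ := (toIcoMod_eq_toIcoMod hp).1 h1
  rw [zsmul_eq_mul] at hn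
  rw [abs_le] at hst
  have hn0 : n = 0 := by
    have h2 : (n : ℝ) < 1 := by nlinarith
    have h3 : (-1 : ℝ) < n := by nlinarith
    have h2' : n < 1 := by exact_mod_cast h2
    have h3' : -1 < n := by exact_mod_cast h3
    omega
  rw [hn0] at hn
  simp at hn
  linarith

section

variable {K : Set Plane} {c : ℝ → Plane}

theorem inner_deriv_eq_zero (hK : IsCompact K) (hc : Differentiable ℝ c)
    (hrange : range c = frontier K) {t θ : ℝ} (h : inner ℝ (c t) (unitVec θ) = suppFun K θ) :
    inner ℝ (deriv c t) (unitVec θ) = (0 : ℝ) := by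
  have hmax : IsLocalMax (fun s => inner ℝ (c s) (unitVec θ)) t :=
    Filter.Eventually.of_forall fun s => by
      simp only
      rw [h]
      exact inner_le_suppFun hK (hK.isClosed.frontier_subset (hrange ▸ mem_range_self s)) θ
  have hd : HasDerivAt (fun s => inner ℝ (c s) (unitVec θ))
      (inner ℝ (deriv c t) (unitVec θ)) t := by
    have := (hc t).hasDerivAt.inner ℝ (hasDerivAt_const t (unitVec θ))
    simpa using this
  exact hmax.hasDerivAt_eq_zero hd

/-- Near a given normal angle the maximal points on the boundary curve stay near a given one. -/
theorem eventually_exists_inner_eq_suppFun (hK : IsCompact K) (hsc : StrictConvex ℝ K)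
    (hc : Continuous c) (hper : Function.Periodic c (2 * Real.pi))
    (hinj : InjOn c (Ico 0 (2 * Real.pi))) (hrange : range c = frontier K) {t₀ θ₀ : ℝ}
    (h₀ : inner ℝ (c t₀) (unitVec θ₀) = suppFun K θ₀) {U : Set ℝ} (hU : U ∈ nhds t₀) :
    ∀ᶠ θ in nhds θ₀, ∃ t ∈ U, inner ℝ (c t) (unitVec θ) = suppFun K θ := by
  have hcK : ∀ t, c t ∈ K := fun t => hK.isClosed.frontier_subset (hrange ▸ mem_range_self t)
  have hu : Continuous unitVec := contDiff_unitVec.continuous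
  obtain ⟨V, hVU, hVo, hVt⟩ := mem_nhds_iff.1 hU
  -- The window covers a full period. By strict convexity the support point for `θ₀` is unique, so
  -- outside `V` the linear functional stays strictly below its value at `t₀`; compactness preserves
  -- this for nearby `θ`.
  have hcomp : IsCompact (Icc (t₀ - Real.pi) (t₀ + Real.pi) \ V) := isCompact_Icc.diff hVo
  have hev : ∀ᶠ θ in nhds θ₀, ∀ t ∈ Icc (t₀ - Real.pi) (t₀ + Real.pi) \ V,
      inner ℝ (c t) (unitVec θ) < (inner ℝ (c t₀) (unitVec θ) : ℝ) := by
    refine hcomp.eventually_forall_of_forall_eventually fun t ht => ?_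
    have hlt : inner ℝ (c t) (unitVec θ₀) < (inner ℝ (c t₀) (unitVec θ₀) : ℝ) := by
      rw [h₀]
      refine lt_of_le_of_ne (inner_le_suppFun hK (hcK t) θ₀) fun heq => ht.2 ?_
      have hct := eq_of_inner_eq_suppFun hK hsc (hcK t) (hcK t₀) heq h₀
      rwa [eq_of_periodic_of_injOn hper hinj hct
        (abs_le.2 ⟨by linarith [ht.1.1], by linarith [ht.1.2]⟩)]
    exact (by fun_prop : Continuous fun z : ℝ × ℝ => (inner ℝ (c z.2) (unitVec z.1) : ℝ)).tendsto
      (θ₀, t) |>.eventually_lt ((by fun_prop : Continuous fun z : ℝ × ℝ =>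
        (inner ℝ (c t₀) (unitVec z.1) : ℝ)).tendsto (θ₀, t)) hlt
  filter_upwards [hev] with θ hθ
  obtain ⟨x, hx, hxθ⟩ := exists_inner_eq_suppFun hK ⟨_, hcK t₀⟩ θ
  have hxf := mem_frontier_of_inner_eq_suppFun hK hx hxθ
  rw [← hrange] at hxf
  obtain ⟨s, rfl⟩ := hxf
  obtain ⟨t, ht, hst⟩ := hper.exists_mem_Ico Real.two_pi_pos s (t₀ - Real.pi)
  rw [hst] at hxθ
  refine ⟨t, ?_, hxθ⟩
  by_contra htU
  have hlt := hθ t ⟨⟨ht.1, by linarith [ht.2]⟩, fun hV => htU (hVU hV)⟩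
  rw [hxθ] at hlt
  exact absurd (inner_le_suppFun hK (hcK t₀) θ) (not_le.2 hlt)

end

/-- The parameter of the support point solves `⟨c'(t), u(θ)⟩ = 0`. Positive curvature makes the
`t`-derivative nonzero, so locally the solution is a smooth `ψ(θ)`, and the support function is
`⟨c(ψ(θ)), u(θ)⟩`. -/
theorem contDiff_suppFun {K : Set Plane} (hK : IsSmoothStrictlyConvexDomain K) :
    ContDiff ℝ ∞ (suppFun K) := by
  obtain ⟨c, hc, hper, hinj, hdet, hrange⟩ := hK.smooth_boundary
  have hKc := hK.isCompact
  have hne : K.Nonempty := hK.interior_nonempty.mono interior_subset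
  have hcd : Differentiable ℝ c := hc.differentiable (by simp)
  have hc' : ContDiff ℝ ∞ (deriv c) := (contDiff_infty_iff_deriv.1 hc).2
  have hc'd : Differentiable ℝ (deriv c) := hc'.differentiable (by simp)
  refine contDiff_iff_contDiffAt.2 fun θ₀ => ?_
  obtain ⟨x, hx, hxθ⟩ := exists_inner_eq_suppFun hKc hne θ₀
  have hxf := mem_frontier_of_inner_eq_suppFun hKc hx hxθ
  rw [← hrange] at hxf
  obtain ⟨t₀, rfl⟩ := hxf
  set G : ℝ × ℝ → ℝ := fun v => inner ℝ (deriv c v.2) (unitVec v.1) with hG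
  have hGs : ContDiff ℝ ∞ G :=
    (hc'.comp contDiff_snd).inner ℝ (contDiff_unitVec.comp contDiff_fst)
  have hGat : ContDiffAt ℝ ∞ G (θ₀, t₀) := hGs.contDiffAt
  have hG0 : G (θ₀, t₀) = 0 := inner_deriv_eq_zero hKc hcd hrange hxθ
  set a : ℝ := inner ℝ (deriv (deriv c) t₀) (unitVec θ₀) with ha
  -- Otherwise `c'` and `c''` are both orthogonal to the same unit vector, hence parallel, against
  -- positive curvature.
  have ha0 : a ≠ 0 := by
    intro h0
    have h1 := hdet t₀
    rw [det2] at h1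
    rw [ha, inner_unitVec] at h0
    simp only [hG] at hG0
    rw [inner_unitVec] at hG0
    have hsq := Real.cos_sq_add_sin_sq θ₀
    have e1 : (deriv c t₀ 0 * deriv (deriv c) t₀ 1 - deriv c t₀ 1 * deriv (deriv c) t₀ 0) *
        Real.cos θ₀ = 0 := by linear_combination (deriv (deriv c) t₀ 1) * hG0 - deriv c t₀ 1 * h0
    have e2 : (deriv c t₀ 0 * deriv (deriv c) t₀ 1 - deriv c t₀ 1 * deriv (deriv c) t₀ 0) *
        Real.sin θ₀ = 0 := by linear_combination deriv c t₀ 0 * h0 - (deriv (deriv c) t₀ 0) * hG0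
    rcases mul_eq_zero.1 e1 with h | h
    · exact h1.ne' h
    · rcases mul_eq_zero.1 e2 with h' | h'
      · exact h1.ne' h'
      · rw [h, h'] at hsq
        norm_num at hsq
  have hinv : (fderiv ℝ G (θ₀, t₀) ∘SL ContinuousLinearMap.inr ℝ ℝ ℝ).IsInvertible := by
    refine ⟨ContinuousLinearEquiv.unitsEquivAut ℝ (Units.mk0 a ha0), ?_⟩
    ext
    have h1 : HasFDerivAt G (fderiv ℝ G (θ₀, t₀)) (θ₀, t₀) :=
      (hGs.differentiable (by simp) _).hasFDerivAt
    have h2 : HasDerivAt (fun t => ((θ₀, t) : ℝ × ℝ)) (0, 1) t₀ :=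
      (hasDerivAt_const t₀ θ₀).prodMk (hasDerivAt_id t₀)
    have h3 := h1.comp_hasDerivAt t₀ h2
    have h4 : HasDerivAt (fun t => G (θ₀, t)) a t₀ := by
      have := (hc'd t₀).hasDerivAt.inner ℝ (hasDerivAt_const t₀ (unitVec θ₀))
      simpa [hG] using this
    have h5 := h3.unique h4
    simp [h5]
  set ψ := hGat.implicitFunction (by simp) hinv with hψ
  have hψs : ContDiffAt ℝ ∞ ψ θ₀ := hGat.contDiffAt_implicitFunction (by simp) hinv
  have hev := hGat.eventually_apply_eq_iff_implicitFunction (by simp) hinv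
  rw [nhds_prod_eq, Filter.eventually_prod_iff] at hev
  obtain ⟨pa, hpa, pb, hpb, hab⟩ := hev
  have hex := eventually_exists_inner_eq_suppFun hKc hK.strictConvex hc.continuous hper hinj hrange
    hxθ hpb
  have heq : suppFun K =ᶠ[nhds θ₀] fun θ => inner ℝ (c (ψ θ)) (unitVec θ) := by
    filter_upwards [hpa, hex] with θ hθ ⟨t, ht, htθ⟩
    have h1 := (hab hθ ht).1 (by
      rw [hG0]
      exact inner_deriv_eq_zero hKc hcd hrange htθ)
    simp only at h1
    rw [← hψ] at h1
    rw [h1, htθ]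
  exact ((hc.contDiffAt.comp θ₀ hψs).inner ℝ contDiff_unitVec.contDiffAt).congr_of_eventuallyEq heq

theorem smoothPeriodic_suppFun {K : Set Plane} (hK : IsSmoothStrictlyConvexDomain K) :
    SmoothPeriodic (suppFun K) := ⟨contDiff_suppFun hK, suppFun_periodic K⟩

/-- The outward unit normal at a boundary point is unique. -/
theorem unitVec_eq_of_inner_eq_suppFun {K : Set Plane} (hK : IsSmoothStrictlyConvexDomain K)
    {x : Plane} (hx : x ∈ K) {θ φ : ℝ} (hθ : inner ℝ x (unitVec θ) = suppFun K θ)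
    (hφ : inner ℝ x (unitVec φ) = suppFun K φ) : unitVec θ = unitVec φ := by
  obtain ⟨c, hc, -, -, hdet, hrange⟩ := hK.smooth_boundary
  have hxf := mem_frontier_of_inner_eq_suppFun hK.isCompact hx hθ
  rw [← hrange] at hxf
  obtain ⟨t, rfl⟩ := hxf
  have hcd : Differentiable ℝ c := hc.differentiable (by simp)
  have h1 := inner_deriv_eq_zero hK.isCompact hcd hrange hθ
  have h2 := inner_deriv_eq_zero hK.isCompact hcd hrange hφ
  rw [inner_unitVec] at h1 h2
  have hsin : Real.sin (φ - θ) = 0 := by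
    rw [Real.sin_sub]
    by_contra hs
    have e0 : deriv c t 0 * (Real.sin φ * Real.cos θ - Real.cos φ * Real.sin θ) = 0 := by
      linear_combination Real.sin φ * h1 - Real.sin θ * h2
    have e1 : deriv c t 1 * (Real.sin φ * Real.cos θ - Real.cos φ * Real.sin θ) = 0 := by
      linear_combination Real.cos θ * h2 - Real.cos φ * h1
    have h := hdet t
    rw [det2, (mul_eq_zero.1 e0).resolve_right hs, (mul_eq_zero.1 e1).resolve_right hs] at h
    simp at h
  have hφθ : φ = θ + (φ - θ) := by ring
  have hcφ : Real.cos φ = Real.cos θ * Real.cos (φ - θ) := by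
    nth_rewrite 1 [hφθ]
    rw [Real.cos_add, hsin, mul_zero, sub_zero]
  have hsφ : Real.sin φ = Real.sin θ * Real.cos (φ - θ) := by
    nth_rewrite 1 [hφθ]
    rw [Real.sin_add, hsin, mul_zero, add_zero]
  rcases Real.sin_eq_zero_iff_cos_eq.1 hsin with h | h
  · simp [unitVec, hcφ, hsφ, h]
  -- Opposite normals at one point would mean width zero in that direction.
  · exfalso
    have he : unitVec φ = unitVec (θ + Real.pi) := by
      simp [unitVec, hcφ, hsφ, h]
    have hw := suppFun_add_suppFun_pi_pos hK.isCompact hK.interior_nonempty θ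
    have hs : suppFun K (θ + Real.pi) = suppFun K φ := by simp only [suppFun, he]
    rw [hs, ← hθ, ← hφ, he, inner_unitVec, inner_unitVec, Real.cos_add_pi, Real.sin_add_pi] at hw
    linarith

/-! ### The boundary curve in terms of the support function -/

/-- The unit tangent vector `(-sin θ, cos θ)`. -/
def tangentVec (θ : ℝ) : Plane := !₂[-Real.sin θ, Real.cos θ]

@[simp] theorem tangentVec_zero (θ : ℝ) : tangentVec θ 0 = -Real.sin θ := by simp [tangentVec]

@[simp] theorem tangentVec_one (θ : ℝ) : tangentVec θ 1 = Real.cos θ := by simp [tangentVec]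

@[simp] theorem norm_tangentVec (θ : ℝ) : ‖tangentVec θ‖ = 1 := by
  simp [EuclideanSpace.norm_eq]

theorem hasDerivAt_plane {c : ℝ → Plane} {c' : Plane} {θ : ℝ} :
    HasDerivAt c c' θ ↔ ∀ i, HasDerivAt (fun t => c t i) (c' i) θ := by
  rw [hasDerivAt_iff_hasFDerivAt, ← hasFDerivWithinAt_univ, hasFDerivWithinAt_euclidean]
  refine forall_congr' fun i => ?_
  rw [hasDerivAt_iff_hasFDerivAt, ← hasFDerivWithinAt_univ]
  have h : PiLp.proj 2 (fun _ : Fin 2 => ℝ) i ∘L ContinuousLinearMap.toSpanSingleton ℝ c' =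
      ContinuousLinearMap.toSpanSingleton ℝ (c' i) := by
    ext
    simp
  rw [← h]

theorem hasDerivAt_unitVec (θ : ℝ) : HasDerivAt unitVec (tangentVec θ) θ :=
  hasDerivAt_plane.2 <| Fin.forall_fin_two.2
    ⟨by simpa using Real.hasDerivAt_cos θ, by simpa using Real.hasDerivAt_sin θ⟩

theorem hasDerivAt_tangentVec (θ : ℝ) : HasDerivAt tangentVec (-unitVec θ) θ :=
  hasDerivAt_plane.2 <| Fin.forall_fin_two.2
    ⟨by simpa using (Real.hasDerivAt_sin θ).fun_neg, by simpa using Real.hasDerivAt_cos θ⟩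

/-- The curvature radius `p + p''` as a function of the support function. -/
def supportRadius (K : Set Plane) (θ : ℝ) : ℝ := suppFun K θ + deriv (deriv (suppFun K)) θ

theorem boundaryCurve_eq (K : Set Plane) (θ : ℝ) :
    boundaryCurve K θ = suppFun K θ • unitVec θ + deriv (suppFun K) θ • tangentVec θ := by
  ext i
  fin_cases i <;> simp [boundaryCurve]
  ring

theorem boundaryCurve_periodic {K : Set Plane} (hp : SmoothPeriodic (suppFun K)) :
    Function.Periodic (boundaryCurve K) (2 * Real.pi) := fun θ => by
  simp only [boundaryCurve, hp.periodic θ, hp.deriv.periodic θ, Real.cos_add_two_pi,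
    Real.sin_add_two_pi]

theorem smoothPeriodic_supportRadius {K : Set Plane} (hp : SmoothPeriodic (suppFun K)) :
    SmoothPeriodic (supportRadius K) := hp.add hp.deriv.deriv

theorem hasDerivAt_boundaryCurve {K : Set Plane} (hp : SmoothPeriodic (suppFun K)) (θ : ℝ) :
    HasDerivAt (boundaryCurve K) (supportRadius K θ • tangentVec θ) θ := by
  have h1 := (hp.hasDerivAt θ).smul (hasDerivAt_unitVec θ)
  have h2 := (hp.deriv.hasDerivAt θ).smul (hasDerivAt_tangentVec θ)
  rw [show boundaryCurve K = _ from funext (boundaryCurve_eq K)]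
  refine (h1.add h2).congr_deriv ?_
  rw [supportRadius, add_smul, smul_neg]
  abel

/-- The symmetric second difference `f` is nonnegative, vanishes at `0` and has second derivative
`2(p + p'')` there. A negative value would make `0` a local maximum, so `f` would vanish near `0`
and its second derivative would be zero. -/
theorem supportRadius_nonneg {K : Set Plane} (hK : IsCompact K) (hne : K.Nonempty)
    (hp : SmoothPeriodic (suppFun K)) (θ : ℝ) : 0 ≤ supportRadius K θ := by
  by_contra! hneg
  set p := suppFun K with hpdef
  set f : ℝ → ℝ := fun h => p (θ + h) + p (θ - h) - 2 * Real.cos h * p θ with hf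
  have hf0 : f 0 = 0 := by simp [hf]; ring
  have hfnn : ∀ h, 0 ≤ f h := fun h => by
    have := two_mul_cos_mul_suppFun_le hK hne θ h
    simp only [hf]
    linarith
  have hd : ∀ h, HasDerivAt f (deriv p (θ + h) - deriv p (θ - h) + 2 * Real.sin h * p θ) h := by
    intro h
    have h1 := (hp.hasDerivAt (θ + h)).comp_const_add θ h
    have h2 := (hp.hasDerivAt (θ - h)).comp_const_sub θ h
    refine ((h1.add h2).sub (((Real.hasDerivAt_cos h).const_mul 2).mul_const (p θ))).congr_deriv ?_
    ring
  have hd2 : HasDerivAt (deriv f) (2 * supportRadius K θ) 0 := by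
    rw [show deriv f = _ from funext fun h => (hd h).deriv]
    have h1 := (hp.deriv.hasDerivAt (θ + 0)).comp_const_add θ 0
    have h2 := (hp.deriv.hasDerivAt (θ - 0)).comp_const_sub θ 0
    refine ((h1.sub h2).add (((Real.hasDerivAt_sin 0).const_mul 2).mul_const (p θ))).congr_deriv ?_
    simp [supportRadius, ← hpdef]
    ring
  have hmax := isLocalMax_of_deriv_deriv_neg (f := f) (x₀ := 0) (by rw [hd2.deriv]; linarith)
    (by rw [(hd 0).deriv]; simp) (hd 0).continuousAt
  have hev : f =ᶠ[nhds 0] fun _ => 0 := by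
    filter_upwards [hmax] with h hh
    exact le_antisymm (hh.trans hf0.le) (hfnn h)
  have h0 : deriv (deriv f) 0 = 0 := by
    rw [hev.deriv.deriv_eq]
    simp
  rw [hd2.deriv] at h0
  linarith

/-- The boundary curve runs through the support points. -/
theorem eq_boundaryCurve {K : Set Plane} (hK : IsCompact K) (hp : SmoothPeriodic (suppFun K))
    {x : Plane} (hx : x ∈ K) {θ : ℝ} (h : inner ℝ x (unitVec θ) = suppFun K θ) :
    x = boundaryCurve K θ := by
  have hmin : IsLocalMin (fun φ => suppFun K φ - inner ℝ x (unitVec φ)) θ :=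
    Filter.Eventually.of_forall fun φ => by
      simp only [h, sub_self]
      exact sub_nonneg.2 (inner_le_suppFun hK hx φ)
  have hd := hmin.hasDerivAt_eq_zero ((hp.hasDerivAt θ).sub (hasDerivAt_inner_unitVec x θ))
  rw [inner_unitVec] at h
  have hsq := Real.cos_sq_add_sin_sq θ
  ext i
  fin_cases i
  · simp [boundaryCurve]
    linear_combination Real.cos θ * h - Real.sin θ * (-hd) - x 0 * hsq
  · simp [boundaryCurve]
    linear_combination Real.sin θ * h + Real.cos θ * (-hd) - x 1 * hsq

/-! ### The area formula via cone coordinates about an interior point -/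

section area

variable {K : Set Plane}

theorem boundaryCurve_mem (hK : IsCompact K) (hne : K.Nonempty) (hp : SmoothPeriodic (suppFun K))
    (θ : ℝ) : boundaryCurve K θ ∈ K := by
  obtain ⟨x, hx, h⟩ := exists_inner_eq_suppFun hK hne θ
  rwa [← eq_boundaryCurve hK hp hx h]

theorem inner_boundaryCurve (K : Set Plane) (θ : ℝ) :
    inner ℝ (boundaryCurve K θ) (unitVec θ) = suppFun K θ := by
  rw [inner_unitVec]
  simp only [boundaryCurve, PiLp.toLp_apply, Matrix.cons_val_zero, Matrix.cons_val_one]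
  linear_combination suppFun K θ * Real.cos_sq_add_sin_sq θ

theorem boundaryCurve_injOn (hK : IsSmoothStrictlyConvexDomain K) :
    InjOn (boundaryCurve K) (Ico 0 (2 * Real.pi)) := by
  intro θ hθ φ hφ h
  have hp := smoothPeriodic_suppFun hK
  have hmem := boundaryCurve_mem hK.isCompact (hK.interior_nonempty.mono interior_subset) hp
  have hu := unitVec_eq_of_inner_eq_suppFun hK (hmem θ) (inner_boundaryCurve K θ)
    (h ▸ inner_boundaryCurve K φ)
  have hc : Real.cos θ = Real.cos φ := by simpa using congrArg (fun v : Plane => v 0) hu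
  have hs : Real.sin θ = Real.sin φ := by simpa using congrArg (fun v : Plane => v 1) hu
  obtain ⟨k, hk⟩ := Real.Angle.angle_eq_iff_two_pi_dvd_sub.1 (Real.Angle.cos_sin_inj hc hs)
  have hpi := Real.two_pi_pos
  have hk0 : k = 0 := by
    have h2 : (k : ℝ) < 1 := by nlinarith [hθ.1, hθ.2, hφ.1, hφ.2]
    have h3 : (-1 : ℝ) < k := by nlinarith [hθ.1, hθ.2, hφ.1, hφ.2]
    have h2' : k < 1 := by exact_mod_cast h2
    have h3' : -1 < k := by exact_mod_cast h3
    omega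
  rw [hk0] at hk
  simp at hk
  linarith

/-- Measure-preserving coordinates on the plane. -/
def planeCoord : Plane ≃ᵐ ℝ × ℝ :=
  (MeasurableEquiv.toLp 2 (Fin 2 → ℝ)).symm.trans MeasurableEquiv.finTwoArrow

theorem measurePreserving_planeCoord : MeasurePreserving planeCoord volume volume :=
  (volume_preserving_finTwoArrow ℝ).comp
    (EuclideanSpace.volume_preserving_symm_measurableEquiv_toLp (Fin 2))

theorem planeCoord_apply (x : Plane) : planeCoord x = (x 0, x 1) := rfl

/-- The map `(s, θ) ↦ z + s (γ(θ) - z)` in coordinates. -/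
def coneMap (K : Set Plane) (z : Plane) (q : ℝ × ℝ) : ℝ × ℝ :=
  planeCoord (z + q.1 • (boundaryCurve K q.2 - z))

theorem hasFDerivAt_coneMap (hp : SmoothPeriodic (suppFun K)) (z : Plane) (q : ℝ × ℝ) :
    HasFDerivAt (coneMap K z)
      (Matrix.toLin (.finTwoProd ℝ) (.finTwoProd ℝ)
        !![boundaryCurve K q.2 0 - z 0, q.1 * (supportRadius K q.2 * -Real.sin q.2);
          boundaryCurve K q.2 1 - z 1,
            q.1 * (supportRadius K q.2 * Real.cos q.2)]).toContinuousLinearMap q := by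
  have hγ := hasDerivAt_plane.1 (hasDerivAt_boundaryCurve hp q.2)
  have h0 : HasDerivAt (fun θ => boundaryCurve K θ 0 - z 0)
      (supportRadius K q.2 * -Real.sin q.2) q.2 := by simpa using (hγ 0).sub_const (z 0)
  have h1 : HasDerivAt (fun θ => boundaryCurve K θ 1 - z 1)
      (supportRadius K q.2 * Real.cos q.2) q.2 := by simpa using (hγ 1).sub_const (z 1)
  have hfst : HasFDerivAt (Prod.fst : ℝ × ℝ → ℝ) (.fst ℝ ℝ ℝ) q := hasFDerivAt_fst
  have hsnd : HasFDerivAt (Prod.snd : ℝ × ℝ → ℝ) (.snd ℝ ℝ ℝ) q := hasFDerivAt_snd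
  have h0' := (hfst.fun_mul (HasDerivAt.comp_hasFDerivAt q h0 hsnd)).const_add (z 0)
  have h1' := (hfst.fun_mul (HasDerivAt.comp_hasFDerivAt q h1 hsnd)).const_add (z 1)
  rw [Matrix.toLin_finTwoProd_toContinuousLinearMap]
  have hcone : coneMap K z = fun q => (z 0 + q.1 * (boundaryCurve K q.2 0 - z 0),
      z 1 + q.1 * (boundaryCurve K q.2 1 - z 1)) := by
    funext q
    simp [coneMap, planeCoord_apply]
  rw [hcone]
  refine (h0'.prodMk h1').congr_fderiv ?_
  ext <;> simp

/-- The gauge centered at `z` recovers the cone parameter: it takes the value `s` at `s (γ(θ) - z)`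
for `s ≥ 0`. Injectivity and surjectivity of the cone map rest on this. -/
theorem gauge_boundaryCurve_sub (hK : IsCompact K) (hc : Convex ℝ K)
    (hp : SmoothPeriodic (suppFun K)) {z : Plane} (hz : z ∈ interior K) (θ : ℝ) :
    gauge ((fun v => z + v) ⁻¹' K) (boundaryCurve K θ - z) = 1 := by
  have hT : (fun v => z + v) ⁻¹' K ∈ nhds (0 : Plane) := by
    refine (continuous_const_add z).continuousAt.preimage_mem_nhds ?_
    simpa using mem_interior_iff_mem_nhds.1 hz
  rw [gauge_eq_one_iff_mem_frontier (hc.translate_preimage_right z) hT]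
  have := (Homeomorph.addLeft z).preimage_frontier K
  simp only [Homeomorph.coe_addLeft] at this
  rw [← this]
  simpa using mem_frontier_of_inner_eq_suppFun hK
    (boundaryCurve_mem hK ⟨z, interior_subset hz⟩ hp θ) (inner_boundaryCurve K θ)

theorem coneMap_injOn (hK : IsSmoothStrictlyConvexDomain K) {z : Plane} (hz : z ∈ interior K) :
    InjOn (coneMap K z) (Ioo 0 1 ×ˢ Ico 0 (2 * Real.pi)) := by
  rintro ⟨s, θ⟩ ⟨hs, hθ⟩ ⟨t, φ⟩ ⟨ht, hφ⟩ h
  have h1 := add_left_cancel (planeCoord.injective h)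
  simp only at h1 hs ht
  have hg := gauge_boundaryCurve_sub hK.isCompact hK.strictConvex.convex
    (smoothPeriodic_suppFun hK) hz
  have h2 := congrArg (gauge ((fun v => z + v) ⁻¹' K)) h1
  rw [gauge_smul_of_nonneg hs.1.le, gauge_smul_of_nonneg ht.1.le, hg, hg] at h2
  simp only [smul_eq_mul, mul_one] at h2
  subst h2
  have h3 := sub_left_injective (smul_right_injective _ hs.1.ne' h1)
  exact Prod.ext rfl (boundaryCurve_injOn hK hθ hφ h3)

theorem exists_coneMap_eq (hK : IsSmoothStrictlyConvexDomain K) {z y : Plane}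
    (hz : z ∈ interior K) (hy : y ∈ interior K) (hyz : y ≠ z) :
    planeCoord y ∈ coneMap K z '' (Ioo 0 1 ×ˢ Ico 0 (2 * Real.pi)) := by
  have hp := smoothPeriodic_suppFun hK
  have hc := hK.strictConvex.convex
  set T := (fun v => z + v) ⁻¹' K with hTdef
  have hTc : Convex ℝ T := hc.translate_preimage_right z
  have hT : T ∈ nhds (0 : Plane) := by
    refine (continuous_const_add z).continuousAt.preimage_mem_nhds ?_
    simpa using mem_interior_iff_mem_nhds.1 hz
  have hfr := (Homeomorph.addLeft z).preimage_frontier K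
  have hin := (Homeomorph.addLeft z).preimage_interior K
  simp only [Homeomorph.coe_addLeft] at hfr hin
  have hb : Bornology.IsVonNBounded ℝ T := by
    rw [NormedSpace.isVonNBounded_iff]
    have : IsCompact ((Homeomorph.addLeft z) ⁻¹' K) :=
      (Homeomorph.addLeft z).isCompact_preimage.2 hK.isCompact
    exact this.isBounded
  set s := gauge T (y - z) with hs
  have hs0 : 0 < s := (gauge_pos (absorbent_nhds_zero hT) hb).2 (sub_ne_zero.2 hyz)
  have hs1 : s < 1 := by
    rw [hs, gauge_lt_one_iff_mem_interior hTc hT, ← hin]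
    simpa using hy
  have hmem : z + s⁻¹ • (y - z) ∈ frontier K := by
    have h1 : gauge T (s⁻¹ • (y - z)) = 1 := by
      rw [gauge_smul_of_nonneg (inv_nonneg.2 hs0.le), ← hs, smul_eq_mul, inv_mul_cancel₀ hs0.ne']
    rw [gauge_eq_one_iff_mem_frontier hTc hT, ← hfr] at h1
    exact h1
  obtain ⟨θ, hθ⟩ := exists_inner_eq_suppFun_of_mem_frontier hK.isCompact hc hmem
    hK.interior_nonempty
  have he := eq_boundaryCurve hK.isCompact hp (hK.isCompact.isClosed.frontier_subset hmem) hθ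
  obtain ⟨φ, hφ, hθφ⟩ := (boundaryCurve_periodic hp).exists_mem_Ico₀ Real.two_pi_pos θ
  rw [hθφ] at he
  refine ⟨(s, φ), ⟨⟨hs0, hs1⟩, hφ⟩, ?_⟩
  simp only [coneMap]
  rw [← he, add_sub_cancel_left, smul_inv_smul₀ hs0.ne', add_sub_cancel]

theorem coneMap_mem (hK : IsSmoothStrictlyConvexDomain K) {z : Plane} (hz : z ∈ interior K)
    {q : ℝ × ℝ} (hq : q ∈ Ioo (0 : ℝ) 1 ×ˢ Ico 0 (2 * Real.pi)) :
    planeCoord.symm (coneMap K z q) ∈ K := by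
  rw [coneMap, MeasurableEquiv.symm_apply_apply]
  exact hK.strictConvex.convex.add_smul_sub_mem (interior_subset hz)
    (boundaryCurve_mem hK.isCompact ⟨z, interior_subset hz⟩ (smoothPeriodic_suppFun hK) _)
    ⟨hq.1.1.le, hq.1.2.le⟩

theorem volume_image_coneMap (hK : IsSmoothStrictlyConvexDomain K) {z : Plane}
    (hz : z ∈ interior K) :
    volume (coneMap K z '' (Ioo 0 1 ×ˢ Ico 0 (2 * Real.pi))) = volume K := by
  have hpre := measurePreserving_planeCoord.measure_preimage_equiv
    (coneMap K z '' (Ioo 0 1 ×ˢ Ico 0 (2 * Real.pi)))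
  rw [← hpre]
  refine le_antisymm (measure_mono ?_) ?_
  · rintro x ⟨q, hq, hx⟩
    have := coneMap_mem hK hz hq
    rwa [hx, MeasurableEquiv.symm_apply_apply] at this
  · have hsub : K ⊆ planeCoord ⁻¹' (coneMap K z '' (Ioo 0 1 ×ˢ Ico 0 (2 * Real.pi))) ∪
        (frontier K ∪ {z}) := by
      intro y hy
      by_cases hyz : y = z
      · exact Or.inr (Or.inr hyz)
      by_cases hyi : y ∈ interior K
      · exact Or.inl (exists_coneMap_eq hK hz hyi hyz)
      · exact Or.inr (Or.inl ⟨subset_closure hy, hyi⟩)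
    refine (measure_mono hsub).trans ((measure_union_le _ _).trans ?_)
    have h0 : volume (frontier K ∪ {z}) = 0 :=
      measure_union_null (hK.strictConvex.convex.addHaar_frontier volume) (by simp)
    rw [h0, add_zero]

/-- The area as an integral of the support function and the curvature radius. -/
theorem area_eq (hK : IsSmoothStrictlyConvexDomain K) :
    area K = 1 / 2 * ∫ θ in (0 : ℝ)..(2 * Real.pi), suppFun K θ * supportRadius K θ := by
  have hp := smoothPeriodic_suppFun hK
  have hR := smoothPeriodic_supportRadius hp
  have hRnn := supportRadius_nonneg hK.isCompact (hK.interior_nonempty.mono interior_subset) hp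
  obtain ⟨z, hz⟩ := hK.interior_nonempty
  have hl := smoothPeriodic_inner_unitVec z
  have hpl : ∀ θ, 0 ≤ suppFun K θ - inner ℝ z (unitVec θ) := fun θ =>
    (sub_pos.2 (inner_lt_suppFun_of_mem_interior hK.isCompact hz θ)).le
  have hcv := integral_image_eq_integral_abs_det_fderiv_smul (volume : Measure (ℝ × ℝ))
    (measurableSet_Ioo.prod measurableSet_Ico)
    (fun q _ => (hasFDerivAt_coneMap hp z q).hasFDerivWithinAt) (coneMap_injOn hK hz)
    (fun _ => (1 : ℝ))
  rw [setIntegral_const, Measure.real, volume_image_coneMap hK hz, smul_eq_mul, mul_one] at hcv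
  rw [area, hcv]
  -- The Jacobian is `s` times the curvature radius times the distance from `z` to the support line.
  -- All factors are nonnegative, which removes the absolute value.
  have hdet : ∀ q ∈ Ioo (0 : ℝ) 1 ×ˢ Ico 0 (2 * Real.pi),
      |((Matrix.toLin (.finTwoProd ℝ) (.finTwoProd ℝ)
        !![boundaryCurve K q.2 0 - z 0, q.1 * (supportRadius K q.2 * -Real.sin q.2);
          boundaryCurve K q.2 1 - z 1,
            q.1 * (supportRadius K q.2 * Real.cos q.2)]).toContinuousLinearMap :
              ℝ × ℝ →L[ℝ] ℝ × ℝ).det| • (1 : ℝ) =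
        q.1 * (supportRadius K q.2 * (suppFun K q.2 - inner ℝ z (unitVec q.2))) := by
    intro q hq
    rw [LinearMap.det_toContinuousLinearMap, LinearMap.det_toLin, Matrix.det_fin_two_of,
      smul_eq_mul, mul_one]
    have h1 := inner_boundaryCurve K q.2
    rw [inner_unitVec] at h1
    rw [← abs_of_nonneg (mul_nonneg hq.1.1.le (mul_nonneg (hRnn q.2) (hpl q.2)))]
    congr 1
    rw [inner_unitVec]
    linear_combination q.1 * supportRadius K q.2 * h1
  rw [setIntegral_congr_fun (measurableSet_Ioo.prod measurableSet_Ico) hdet,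
    Measure.volume_eq_prod,
    setIntegral_prod_mul (fun s : ℝ => s)
      (fun θ => supportRadius K θ * (suppFun K θ - inner ℝ z (unitVec θ))),
    integral_Ico_eq_integral_Ioc, ← integral_Ioc_eq_integral_Ioo,
    ← intervalIntegral.integral_of_le zero_le_one,
    ← intervalIntegral.integral_of_le Real.two_pi_pos.le, integral_id]
  -- First harmonics are annihilated by `1 + d²/dθ²`, so the choice of `z` drops out.
  have h0 : ∫ θ in (0 : ℝ)..(2 * Real.pi), supportRadius K θ * inner ℝ z (unitVec θ) = 0 := by
    have h1 := hp.integral_deriv_deriv_mul hl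
    simp_rw [deriv_deriv_inner_unitVec] at h1
    simp only [supportRadius, add_mul]
    rw [intervalIntegral.integral_add
      ((hp.mul hl).continuous.intervalIntegrable _ _)
      ((hp.deriv.deriv.mul hl).continuous.intervalIntegrable _ _), h1]
    simp
  have hsplit : ∫ θ in (0 : ℝ)..(2 * Real.pi),
      supportRadius K θ * (suppFun K θ - inner ℝ z (unitVec θ)) =
      ∫ θ in (0 : ℝ)..(2 * Real.pi), suppFun K θ * supportRadius K θ := by
    simp only [mul_sub]
    rw [intervalIntegral.integral_sub ((hR.mul hp).continuous.intervalIntegrable _ _)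
      ((hR.mul hl).continuous.intervalIntegrable _ _), h0, sub_zero]
    exact intervalIntegral.integral_congr fun θ _ => mul_comm _ _
  rw [hsplit]
  norm_num

end area

/-! ### Energies of periodic functions -/

/-- The squared `L²` norm on the circle. -/
def energy (f : ℝ → ℝ) : ℝ := ∫ θ in (0 : ℝ)..(2 * Real.pi), f θ ^ 2

theorem energy_nonneg (f : ℝ → ℝ) : 0 ≤ energy f :=
  intervalIntegral.integral_nonneg Real.two_pi_pos.le fun _ _ => sq_nonneg _

namespace SmoothPeriodic

variable {f : ℝ → ℝ}

theorem intervalIntegrable (hf : SmoothPeriodic f) :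
    IntervalIntegrable f volume 0 (2 * Real.pi) := hf.continuous.intervalIntegrable _ _

theorem integral_mul_deriv_deriv (hf : SmoothPeriodic f) :
    ∫ θ in (0 : ℝ)..(2 * Real.pi), f θ * _root_.deriv (_root_.deriv f) θ =
      -energy (_root_.deriv f) := by
  have h := hf.integral_deriv_mul hf.deriv
  simp only [energy, sq]
  rw [h, neg_neg]

theorem energy_deriv_deriv_add (hf : SmoothPeriodic f) (k : ℝ) :
    energy (fun θ => _root_.deriv (_root_.deriv f) θ + k * f θ) =
      energy (_root_.deriv (_root_.deriv f)) - 2 * k * energy (_root_.deriv f)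
        + k ^ 2 * energy f := by
  have h := hf.integral_mul_deriv_deriv
  have hff := hf.mul hf.deriv.deriv
  have e : energy (fun θ => _root_.deriv (_root_.deriv f) θ + k * f θ) =
      energy (_root_.deriv (_root_.deriv f)) +
        2 * k * (∫ θ in (0 : ℝ)..(2 * Real.pi), f θ * _root_.deriv (_root_.deriv f) θ)
        + k ^ 2 * energy f := by
    simp only [energy, sq]
    rw [← intervalIntegral.integral_const_mul, ← intervalIntegral.integral_const_mul,
      ← intervalIntegral.integral_add (hf.deriv.deriv.mul hf.deriv.deriv).intervalIntegrable
        (hff.const_mul _).intervalIntegrable,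
      ← intervalIntegral.integral_add
        ((hf.deriv.deriv.mul hf.deriv.deriv).add (hff.const_mul _)).intervalIntegrable
        ((hf.mul hf).const_mul _).intervalIntegrable]
    exact intervalIntegral.integral_congr fun θ _ => by ring
  rw [e, h]
  ring

end SmoothPeriodic

/-! ### Perimeter, curvature radius and evolute in terms of the support function -/

section quantities

variable {K : Set Plane}

theorem deriv_boundaryCurve (hp : SmoothPeriodic (suppFun K)) :
    deriv (boundaryCurve K) = fun θ => supportRadius K θ • tangentVec θ :=
  funext fun θ => (hasDerivAt_boundaryCurve hp θ).deriv

theorem integral_supportRadius (hp : SmoothPeriodic (suppFun K)) :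
    ∫ θ in (0 : ℝ)..(2 * Real.pi), supportRadius K θ =
      ∫ θ in (0 : ℝ)..(2 * Real.pi), suppFun K θ := by
  simp only [supportRadius]
  rw [intervalIntegral.integral_add hp.intervalIntegrable hp.deriv.deriv.intervalIntegrable,
    hp.deriv.integral_deriv, add_zero]

theorem perimeter_eq (hK : IsCompact K) (hne : K.Nonempty) (hp : SmoothPeriodic (suppFun K)) :
    perimeter K = ∫ θ in (0 : ℝ)..(2 * Real.pi), suppFun K θ := by
  rw [← integral_supportRadius hp, perimeter, curveLength, deriv_boundaryCurve hp]
  refine intervalIntegral.integral_congr fun θ _ => ?_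
  simp [norm_smul, abs_of_nonneg (supportRadius_nonneg hK hne hp θ)]

theorem perimeter_pos (hK : IsCompact K) (hint : (interior K).Nonempty)
    (hp : SmoothPeriodic (suppFun K)) : 0 < perimeter K := by
  obtain ⟨z, hz⟩ := hint
  have hl := smoothPeriodic_inner_unitVec z
  have h0 : ∫ θ in (0 : ℝ)..(2 * Real.pi), inner ℝ z (unitVec θ) = (0 : ℝ) := by
    have := hl.deriv.integral_deriv
    simp_rw [deriv_deriv_inner_unitVec] at this
    rw [intervalIntegral.integral_neg] at this
    linarith
  have hpos : 0 < ∫ θ in (0 : ℝ)..(2 * Real.pi), (suppFun K θ - inner ℝ z (unitVec θ)) :=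
    intervalIntegral.intervalIntegral_pos_of_pos (hp.sub hl).intervalIntegrable
      (fun θ => sub_pos.2 (inner_lt_suppFun_of_mem_interior hK hz θ)) Real.two_pi_pos
  rw [intervalIntegral.integral_sub hp.intervalIntegrable hl.intervalIntegrable, h0, sub_zero,
    ← perimeter_eq hK ⟨z, interior_subset hz⟩ hp] at hpos
  exact hpos

theorem hasDerivAt_smul_tangentVec {g : ℝ → ℝ} (hg : SmoothPeriodic g) (θ : ℝ) :
    HasDerivAt (fun θ => g θ • tangentVec θ) (deriv g θ • tangentVec θ - g θ • unitVec θ) θ := by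
  refine ((hg.hasDerivAt θ).smul (hasDerivAt_tangentVec θ)).congr_deriv ?_
  rw [smul_neg]
  abel

theorem hasDerivAt_smul_unitVec {g : ℝ → ℝ} (hg : SmoothPeriodic g) (θ : ℝ) :
    HasDerivAt (fun θ => g θ • unitVec θ) (deriv g θ • unitVec θ + g θ • tangentVec θ) θ := by
  refine ((hg.hasDerivAt θ).smul (hasDerivAt_unitVec θ)).congr_deriv ?_
  abel

theorem rho_eq (hK : IsCompact K) (hne : K.Nonempty) (hp : SmoothPeriodic (suppFun K)) (θ : ℝ) :
    rho K θ = supportRadius K θ := by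
  have hR := smoothPeriodic_supportRadius hp
  rw [rho, kappa, curvature, deriv_boundaryCurve hp, (hasDerivAt_smul_tangentVec hR θ).deriv]
  have hdet : det2 (supportRadius K θ • tangentVec θ)
      (deriv (supportRadius K) θ • tangentVec θ - supportRadius K θ • unitVec θ) =
      supportRadius K θ ^ 2 := by
    simp only [det2, PiLp.smul_apply, PiLp.sub_apply, tangentVec_zero, tangentVec_one,
      unitVec_zero, unitVec_one, smul_eq_mul]
    linear_combination supportRadius K θ ^ 2 * Real.sin_sq_add_cos_sq θ
  rw [hdet, norm_smul, norm_tangentVec, mul_one, Real.norm_eq_abs,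
    abs_of_nonneg (supportRadius_nonneg hK hne hp θ)]
  -- Only nonnegativity of the radius is available here; at a zero both sides are `0` by the
  -- convention for division.
  rcases eq_or_ne (supportRadius K θ) 0 with h | h
  · simp [h]
  · field_simp

theorem evolute_eq (hK : IsCompact K) (hne : K.Nonempty) (hp : SmoothPeriodic (suppFun K)) :
    evolute K = fun θ => deriv (suppFun K) θ • tangentVec θ -
      deriv (deriv (suppFun K)) θ • unitVec θ := by
  funext θ
  rw [evolute, rho_eq hK hne hp, boundaryCurve_eq, supportRadius, smul_neg, add_smul]
  abel

/-- The tangential parts of `γ'` and of `(ρ u)'` cancel, leaving a purely normal velocity. -/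
theorem deriv_evolute (hK : IsCompact K) (hne : K.Nonempty) (hp : SmoothPeriodic (suppFun K)) :
    deriv (evolute K) = fun θ => -(deriv (supportRadius K) θ • unitVec θ) := by
  have hR := smoothPeriodic_supportRadius hp
  funext θ
  have he : evolute K = fun θ => boundaryCurve K θ - supportRadius K θ • unitVec θ := by
    funext θ
    rw [evolute, rho_eq hK hne hp, smul_neg, sub_eq_add_neg]
  rw [he, ((hasDerivAt_boundaryCurve hp θ).fun_sub (hasDerivAt_smul_unitVec hR θ)).deriv]
  abel

theorem evoluteArea_eq (hK : IsCompact K) (hne : K.Nonempty) (hp : SmoothPeriodic (suppFun K)) :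
    evoluteArea K = 1 / 2 * ∫ θ in (0 : ℝ)..(2 * Real.pi),
      deriv (suppFun K) θ * deriv (supportRadius K) θ := by
  rw [evoluteArea, orientedArea, deriv_evolute hK hne hp, evolute_eq hK hne hp]
  congr 1
  refine intervalIntegral.integral_congr fun θ _ => ?_
  simp only [det2, PiLp.smul_apply, PiLp.sub_apply, PiLp.neg_apply, tangentVec_zero,
    tangentVec_one, unitVec_zero, unitVec_one, smul_eq_mul]
  linear_combination deriv (suppFun K) θ * deriv (supportRadius K) θ * Real.sin_sq_add_cos_sq θ

theorem rhoEvolute_eq (hK : IsCompact K) (hne : K.Nonempty) (hp : SmoothPeriodic (suppFun K))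
    (θ : ℝ) : rhoEvolute K θ = |deriv (supportRadius K) θ| := by
  have hR := smoothPeriodic_supportRadius hp
  have hd2 : deriv (deriv (evolute K)) θ = -(deriv (deriv (supportRadius K)) θ • unitVec θ
      + deriv (supportRadius K) θ • tangentVec θ) := by
    rw [deriv_evolute hK hne hp]
    exact (hasDerivAt_smul_unitVec hR.deriv θ).fun_neg.deriv
  rw [rhoEvolute, curvature, hd2, deriv_evolute hK hne hp]
  have hnorm : ‖-(deriv (supportRadius K) θ • unitVec θ)‖ = |deriv (supportRadius K) θ| := by
    rw [norm_neg, norm_smul, norm_unitVec, mul_one, Real.norm_eq_abs]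
  have hdet : det2 (-(deriv (supportRadius K) θ • unitVec θ))
      (-(deriv (deriv (supportRadius K)) θ • unitVec θ
        + deriv (supportRadius K) θ • tangentVec θ)) = |deriv (supportRadius K) θ| ^ 2 := by
    rw [sq_abs]
    simp only [det2, PiLp.smul_apply, PiLp.add_apply, PiLp.neg_apply, tangentVec_zero,
      tangentVec_one, unitVec_zero, unitVec_one, smul_eq_mul]
    linear_combination deriv (supportRadius K) θ ^ 2 * Real.sin_sq_add_cos_sq θ
  rw [hnorm, hdet]
  rcases eq_or_ne (deriv (supportRadius K) θ) 0 with h | h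
  · simp [h]
  · have hne0 : -(deriv (supportRadius K) θ • unitVec θ) ≠ 0 := by
      rw [← norm_pos_iff, hnorm]
      exact abs_pos.2 h
    have habs : |deriv (supportRadius K) θ| ≠ 0 := abs_ne_zero.2 h
    rw [if_neg hne0]
    rw [show 1 / (|deriv (supportRadius K) θ| ^ 2 / |deriv (supportRadius K) θ| ^ 3) =
      |deriv (supportRadius K) θ| by field_simp, abs_abs]

theorem curvatureEnergy_nonneg (K : Set Plane) : 0 ≤ curvatureEnergy K :=
  intervalIntegral.integral_nonneg Real.two_pi_pos.le fun _ _ => by positivity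

end quantities

/-! ### Deviation of the support function from that of a disk -/

section deviation

variable {K : Set Plane}

/-- The difference of the support function of `K` and that of the disk with center `x` and
radius `t`. -/
def diskGap (K : Set Plane) (x : Plane) (t : ℝ) (θ : ℝ) : ℝ :=
  suppFun K θ - inner ℝ x (unitVec θ) - t

/-- The difference of the support functions of `K` and of its Steiner disk. -/
def deviation (K : Set Plane) : ℝ → ℝ :=
  diskGap K (steinerPoint K) (perimeter K / (2 * Real.pi))

theorem smoothPeriodic_diskGap (hp : SmoothPeriodic (suppFun K)) (x : Plane) (t : ℝ) :
    SmoothPeriodic (diskGap K x t) :=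
  (hp.sub (smoothPeriodic_inner_unitVec x)).sub (SmoothPeriodic.const t)

theorem smoothPeriodic_deviation (hp : SmoothPeriodic (suppFun K)) :
    SmoothPeriodic (deviation K) := smoothPeriodic_diskGap hp _ _

theorem deriv_deriv_diskGap (hp : SmoothPeriodic (suppFun K)) (x : Plane) (t θ : ℝ) :
    deriv (deriv (diskGap K x t)) θ = deriv (deriv (suppFun K)) θ + inner ℝ x (unitVec θ) := by
  have hl := smoothPeriodic_inner_unitVec x
  have h1 : deriv (diskGap K x t) =
      fun θ => deriv (suppFun K) θ - deriv (fun θ => inner ℝ x (unitVec θ)) θ :=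
    funext fun θ => (((hp.hasDerivAt θ).fun_sub (hl.hasDerivAt θ)).sub_const t).deriv
  rw [h1, ((hp.deriv.hasDerivAt θ).fun_sub (hl.deriv.hasDerivAt θ)).deriv,
    deriv_deriv_inner_unitVec, sub_neg_eq_add]

theorem diskGap_add_deriv_deriv (hp : SmoothPeriodic (suppFun K)) (x : Plane) (t θ : ℝ) :
    diskGap K x t θ + deriv (deriv (diskGap K x t)) θ = supportRadius K θ - t := by
  rw [deriv_deriv_diskGap hp, diskGap, supportRadius]
  ring

theorem supportRadius_eq (hp : SmoothPeriodic (suppFun K)) (θ : ℝ) :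
    supportRadius K θ = perimeter K / (2 * Real.pi) +
      (deviation K θ + deriv (deriv (deviation K)) θ) := by
  rw [deviation, diskGap_add_deriv_deriv hp]
  ring

theorem integral_inner_unitVec_mul_cos (x : Plane) :
    ∫ θ in (0 : ℝ)..(2 * Real.pi), inner ℝ x (unitVec θ) * Real.cos θ = Real.pi * x 0 := by
  have h : ∀ θ, inner ℝ x (unitVec θ) * Real.cos θ =
      x 0 * Real.cos θ ^ 2 + x 1 * (Real.sin θ * Real.cos θ) := fun θ => by
    rw [inner_unitVec]; ring
  simp_rw [h]
  rw [intervalIntegral.integral_add (Continuous.intervalIntegrable (by fun_prop) _ _)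
    (Continuous.intervalIntegrable (by fun_prop) _ _), intervalIntegral.integral_const_mul,
    intervalIntegral.integral_const_mul, integral_cos_sq, integral_sin_mul_cos₁]
  simp
  ring

theorem integral_inner_unitVec_mul_sin (x : Plane) :
    ∫ θ in (0 : ℝ)..(2 * Real.pi), inner ℝ x (unitVec θ) * Real.sin θ = Real.pi * x 1 := by
  have h : ∀ θ, inner ℝ x (unitVec θ) * Real.sin θ =
      x 0 * (Real.sin θ * Real.cos θ) + x 1 * Real.sin θ ^ 2 := fun θ => by
    rw [inner_unitVec]; ring
  simp_rw [h]
  rw [intervalIntegral.integral_add (Continuous.intervalIntegrable (by fun_prop) _ _)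
    (Continuous.intervalIntegrable (by fun_prop) _ _), intervalIntegral.integral_const_mul,
    intervalIntegral.integral_const_mul, integral_sin_sq, integral_sin_mul_cos₁]
  simp
  ring

theorem integral_inner_unitVec (x : Plane) :
    ∫ θ in (0 : ℝ)..(2 * Real.pi), inner ℝ x (unitVec θ) = (0 : ℝ) := by
  have := (smoothPeriodic_inner_unitVec x).deriv.integral_deriv
  simp_rw [deriv_deriv_inner_unitVec] at this
  rw [intervalIntegral.integral_neg] at this
  linarith

theorem integral_diskGap (hK : IsCompact K) (hne : K.Nonempty) (hp : SmoothPeriodic (suppFun K))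
    (x : Plane) (t : ℝ) : ∫ θ in (0 : ℝ)..(2 * Real.pi), diskGap K x t θ =
      2 * Real.pi * (perimeter K / (2 * Real.pi) - t) := by
  have hl := smoothPeriodic_inner_unitVec x
  simp only [diskGap]
  rw [intervalIntegral.integral_sub (hp.sub hl).intervalIntegrable
    (SmoothPeriodic.const t).intervalIntegrable,
    intervalIntegral.integral_sub hp.intervalIntegrable hl.intervalIntegrable,
    integral_inner_unitVec, ← perimeter_eq hK hne hp, intervalIntegral.integral_const]
  have := Real.pi_ne_zero
  simp only [smul_eq_mul]
  field_simp
  ring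

theorem integral_deviation (hK : IsCompact K) (hne : K.Nonempty)
    (hp : SmoothPeriodic (suppFun K)) :
    ∫ θ in (0 : ℝ)..(2 * Real.pi), deviation K θ = 0 := by
  rw [deviation, integral_diskGap hK hne hp, sub_self, mul_zero]

theorem integral_deviation_mul_cos (hp : SmoothPeriodic (suppFun K)) :
    ∫ θ in (0 : ℝ)..(2 * Real.pi), deviation K θ * Real.cos θ = 0 := by
  have hl := smoothPeriodic_inner_unitVec (steinerPoint K)
  have hcos := SmoothPeriodic.cos
  simp only [deviation, diskGap, sub_mul]
  rw [intervalIntegral.integral_sub ((hp.mul hcos).sub (hl.mul hcos)).intervalIntegrable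
    (hcos.const_mul _).intervalIntegrable,
    intervalIntegral.integral_sub (hp.mul hcos).intervalIntegrable
      (hl.mul hcos).intervalIntegrable,
    integral_inner_unitVec_mul_cos, intervalIntegral.integral_const_mul, integral_cos]
  simp [steinerPoint]

theorem integral_deviation_mul_sin (hp : SmoothPeriodic (suppFun K)) :
    ∫ θ in (0 : ℝ)..(2 * Real.pi), deviation K θ * Real.sin θ = 0 := by
  have hl := smoothPeriodic_inner_unitVec (steinerPoint K)
  have hsin := SmoothPeriodic.sin
  simp only [deviation, diskGap, sub_mul]
  rw [intervalIntegral.integral_sub ((hp.mul hsin).sub (hl.mul hsin)).intervalIntegrable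
    (hsin.const_mul _).intervalIntegrable,
    intervalIntegral.integral_sub (hp.mul hsin).intervalIntegrable
      (hl.mul hsin).intervalIntegrable,
    integral_inner_unitVec_mul_sin, intervalIntegral.integral_const_mul, integral_sin]
  simp [steinerPoint]

/-- The left side is `∫ f (f + f'')`. Since `1 + d²/dθ²` kills the first harmonics and is symmetric,
only the mean of `f` and the deviation contribute; the center `x` does not matter. -/
theorem energy_diskGap_sub (hK : IsCompact K) (hne : K.Nonempty)
    (hp : SmoothPeriodic (suppFun K)) (x : Plane) (t : ℝ) :
    energy (diskGap K x t) - energy (deriv (diskGap K x t)) =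
      2 * Real.pi * (perimeter K / (2 * Real.pi) - t) ^ 2 +
        energy (deviation K) - energy (deriv (deviation K)) := by
  set c := perimeter K / (2 * Real.pi) with hc
  have hf := smoothPeriodic_diskGap hp x t
  have hr := smoothPeriodic_deviation hp
  set f := diskGap K x t with hfdef
  set r := deviation K with hrdef
  have hff : ∀ θ, f θ + deriv (deriv f) θ = (c - t) + (r θ + deriv (deriv r) θ) := fun θ => by
    rw [hfdef, diskGap_add_deriv_deriv hp, supportRadius_eq hp]
    ring
  have e1 : energy f - energy (deriv f) =
      ∫ θ in (0 : ℝ)..(2 * Real.pi), f θ * (f θ + deriv (deriv f) θ) := by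
    rw [sub_eq_add_neg, ← hf.integral_mul_deriv_deriv, energy]
    simp only [sq, mul_add]
    rw [intervalIntegral.integral_add (hf.mul hf).intervalIntegrable
      (hf.mul hf.deriv.deriv).intervalIntegrable]
  have e2 : ∫ θ in (0 : ℝ)..(2 * Real.pi), f θ * (r θ + deriv (deriv r) θ) =
      ∫ θ in (0 : ℝ)..(2 * Real.pi), (f θ + deriv (deriv f) θ) * r θ := by
    simp only [mul_add, add_mul]
    rw [intervalIntegral.integral_add (hf.mul hr).intervalIntegrable
      (hf.mul hr.deriv.deriv).intervalIntegrable,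
      intervalIntegral.integral_add (hf.mul hr).intervalIntegrable
      (hf.deriv.deriv.mul hr).intervalIntegrable, hf.integral_deriv_deriv_mul hr]
  have e3 : ∫ θ in (0 : ℝ)..(2 * Real.pi), (f θ + deriv (deriv f) θ) * r θ =
      energy r - energy (deriv r) := by
    simp_rw [hff, add_mul]
    rw [intervalIntegral.integral_add (hr.const_mul _).intervalIntegrable
      ((hr.mul hr).add (hr.deriv.deriv.mul hr)).intervalIntegrable,
      intervalIntegral.integral_const_mul, hrdef, integral_deviation hK hne hp, ← hrdef,
      intervalIntegral.integral_add (hr.mul hr).intervalIntegrable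
      (hr.deriv.deriv.mul hr).intervalIntegrable, sub_eq_add_neg (energy r),
      ← hr.integral_mul_deriv_deriv]
    rw [mul_zero, zero_add]
    simp only [energy, sq, mul_comm]
  rw [e1]
  simp_rw [hff, mul_add (f _) (c - t)]
  rw [intervalIntegral.integral_add (hf.mul (SmoothPeriodic.const _)).intervalIntegrable
    (hf.mul (hr.add hr.deriv.deriv)).intervalIntegrable, e2, e3,
    intervalIntegral.integral_mul_const, hfdef, integral_diskGap hK hne hp, ← hc]
  ring

theorem area_eq_energy (hK : IsSmoothStrictlyConvexDomain K) :
    area K = Real.pi * (perimeter K / (2 * Real.pi)) ^ 2 +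
      1 / 2 * (energy (deviation K) - energy (deriv (deviation K))) := by
  have hp := smoothPeriodic_suppFun hK
  have h := energy_diskGap_sub hK.isCompact (hK.interior_nonempty.mono interior_subset) hp 0 0
  have hgap : diskGap K 0 0 = suppFun K := by
    funext θ
    simp [diskGap]
  rw [hgap, sub_zero] at h
  have e : ∫ θ in (0 : ℝ)..(2 * Real.pi), suppFun K θ * supportRadius K θ =
      energy (suppFun K) - energy (deriv (suppFun K)) := by
    rw [sub_eq_add_neg, ← hp.integral_mul_deriv_deriv, energy]
    simp only [supportRadius, sq, mul_add]
    rw [intervalIntegral.integral_add (hp.mul hp).intervalIntegrable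
      (hp.mul hp.deriv.deriv).intervalIntegrable]
  rw [area_eq hK, e, h]
  ring

theorem energy_supportRadius_sub (hp : SmoothPeriodic (suppFun K)) :
    energy (fun θ => supportRadius K θ - perimeter K / (2 * Real.pi)) =
      energy (deviation K) - 2 * energy (deriv (deviation K))
        + energy (deriv (deriv (deviation K))) := by
  have h := (smoothPeriodic_deviation hp).energy_deriv_deriv_add 1
  have e : (fun θ => supportRadius K θ - perimeter K / (2 * Real.pi)) =
      fun θ => deriv (deriv (deviation K)) θ + 1 * deviation K θ := by
    funext θ
    rw [supportRadius_eq hp]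
    ring
  rw [e, h]
  ring

/-- Mean and variance: the curvature radius has mean `L/(2π)`, so the cross term vanishes. The value
`m = 0` gives `∫ρ²`, the midpoint of the range gives Popoviciu's inequality. -/
theorem energy_supportRadius_sub_const (hK : IsCompact K) (hne : K.Nonempty)
    (hp : SmoothPeriodic (suppFun K)) (m : ℝ) :
    energy (fun θ => supportRadius K θ - m) =
      2 * Real.pi * (perimeter K / (2 * Real.pi) - m) ^ 2 + (energy (deviation K)
        - 2 * energy (deriv (deviation K)) + energy (deriv (deriv (deviation K)))) := by
  have hR := smoothPeriodic_supportRadius hp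
  set c := perimeter K / (2 * Real.pi) with hc
  have hRc := hR.sub (SmoothPeriodic.const c)
  rw [← energy_supportRadius_sub hp, ← hc]
  have hint : ∫ θ in (0 : ℝ)..(2 * Real.pi), (supportRadius K θ - c) = 0 := by
    rw [intervalIntegral.integral_sub hR.intervalIntegrable
      (SmoothPeriodic.const c).intervalIntegrable, integral_supportRadius hp,
      ← perimeter_eq hK hne hp, intervalIntegral.integral_const, hc]
    have := Real.pi_ne_zero
    simp only [smul_eq_mul]
    field_simp
    ring
  have e : ∀ θ, (supportRadius K θ - m) ^ 2 = (c - m) ^ 2 +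
      (2 * (c - m) * (supportRadius K θ - c) + (supportRadius K θ - c) * (supportRadius K θ - c)) :=
    fun θ => by ring
  simp only [energy]
  simp_rw [e]
  rw [intervalIntegral.integral_add (SmoothPeriodic.const _).intervalIntegrable
    ((hRc.const_mul _).add (hRc.mul hRc)).intervalIntegrable,
    intervalIntegral.integral_add (hRc.const_mul _).intervalIntegrable
    (hRc.mul hRc).intervalIntegrable, intervalIntegral.integral_const_mul, hint,
    intervalIntegral.integral_const]
  simp only [sq, smul_eq_mul]
  ring

theorem integral_rho_sq (hK : IsCompact K) (hne : K.Nonempty) (hp : SmoothPeriodic (suppFun K)) :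
    ∫ θ in (0 : ℝ)..(2 * Real.pi), rho K θ ^ 2 =
      2 * Real.pi * (perimeter K / (2 * Real.pi)) ^ 2 + (energy (deviation K)
        - 2 * energy (deriv (deviation K)) + energy (deriv (deriv (deviation K)))) := by
  have h := energy_supportRadius_sub_const hK hne hp 0
  simp only [sub_zero] at h
  rw [← h]
  simp only [rho_eq hK hne hp, energy]

theorem deriv_supportRadius (hp : SmoothPeriodic (suppFun K)) (θ : ℝ) :
    deriv (supportRadius K) θ =
      deriv (deviation K) θ + deriv (deriv (deriv (deviation K))) θ := by
  have hr := smoothPeriodic_deviation hp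
  rw [show supportRadius K = _ from funext (supportRadius_eq hp)]
  exact (((hr.hasDerivAt θ).fun_add (hr.deriv.deriv.hasDerivAt θ)).const_add _).deriv

theorem integral_rhoEvolute_sq (hK : IsCompact K) (hne : K.Nonempty)
    (hp : SmoothPeriodic (suppFun K)) :
    ∫ θ in (0 : ℝ)..(2 * Real.pi), rhoEvolute K θ ^ 2 =
      energy (deriv (deviation K)) - 2 * energy (deriv (deriv (deviation K)))
        + energy (deriv (deriv (deriv (deviation K)))) := by
  have h := (smoothPeriodic_deviation hp).deriv.energy_deriv_deriv_add 1
  simp only [rhoEvolute_eq hK hne hp, sq_abs, deriv_supportRadius hp]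
  simp only [energy, one_mul, add_comm] at h ⊢
  rw [h]
  ring

/-- Symmetry of `1 + d²/dθ²` allows `p'` to be replaced by `r'`, as they differ only by a first
harmonic. -/
theorem evoluteArea_eq_energy (hK : IsCompact K) (hne : K.Nonempty)
    (hp : SmoothPeriodic (suppFun K)) :
    evoluteArea K =
      1 / 2 * (energy (deriv (deviation K)) - energy (deriv (deriv (deviation K)))) := by
  have hr := smoothPeriodic_deviation hp
  rw [evoluteArea_eq hK hne hp]
  congr 1
  set r := deviation K with hrdef
  have hR : ∀ θ, deriv (suppFun K) θ + deriv (deriv (deriv (suppFun K))) θ =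
      deriv r θ + deriv (deriv (deriv r)) θ := fun θ => by
    rw [hrdef, ← deriv_supportRadius hp]
    exact ((hp.hasDerivAt θ).fun_add (hp.deriv.deriv.hasDerivAt θ)).deriv.symm
  simp only [deriv_supportRadius hp, ← hrdef, mul_add]
  rw [intervalIntegral.integral_add (hp.deriv.mul hr.deriv).intervalIntegrable
    (hp.deriv.mul hr.deriv.deriv.deriv).intervalIntegrable,
    ← hp.deriv.integral_deriv_deriv_mul hr.deriv,
    ← intervalIntegral.integral_add (hp.deriv.mul hr.deriv).intervalIntegrable
      (hp.deriv.deriv.deriv.mul hr.deriv).intervalIntegrable]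
  simp_rw [← add_mul, hR, add_mul]
  rw [intervalIntegral.integral_add (hr.deriv.mul hr.deriv).intervalIntegrable
    (hr.deriv.deriv.deriv.mul hr.deriv).intervalIntegrable, sub_eq_add_neg,
    ← hr.deriv.integral_mul_deriv_deriv]
  simp only [energy, sq, mul_comm]

theorem h2_steinerDisk_sq (hL : 0 ≤ perimeter K) :
    h2 K (steinerDisk K) ^ 2 = energy (deviation K) := by
  have hs : ∀ θ, suppFun K θ - suppFun (steinerDisk K) θ = deviation K θ := fun θ => by
    rw [steinerDisk, suppFun_closedBall _ (div_nonneg hL Real.two_pi_pos.le), deviation, diskGap]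
    ring
  rw [h2, Real.sq_sqrt]
  · simp only [hs, sq_abs, energy]
  · exact intervalIntegral.integral_nonneg Real.two_pi_pos.le fun _ _ => sq_nonneg _

end deviation

/-! ### Circumradius, inradius and Bonnesen's inequality -/

section bonnesen

variable {K : Set Plane}

theorem inner_unitVec_unitVec (φ θ : ℝ) :
    inner ℝ (unitVec φ) (unitVec θ) = Real.cos (θ - φ) := by
  rw [inner_unitVec, unitVec_zero, unitVec_one, Real.cos_sub]
  ring

theorem inner_unitVec_add_pi (x : Plane) (θ : ℝ) :
    inner ℝ x (unitVec (θ + Real.pi)) = -inner ℝ x (unitVec θ) := by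
  simp only [inner_unitVec, Real.cos_add_pi, Real.sin_add_pi]
  ring

/-- A nonnegative continuous function on the circle that is positive on a closed half circle
becomes uniformly positive after subtraction of a suitable first harmonic. -/
theorem exists_pos_le_sub_inner {g : ℝ → ℝ} (hg : Continuous g)
    (hper : Function.Periodic g (2 * Real.pi)) (hnn : ∀ θ, 0 ≤ g θ) {a : ℝ}
    (ha : ∀ θ ∈ Icc a (a + Real.pi), 0 < g θ) :
    ∃ (y : Plane) (m : ℝ), 0 < m ∧ ∀ θ, m ≤ g θ - inner ℝ y (unitVec θ) := by
  have hpi := Real.pi_pos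
  obtain ⟨t, ht, hmin⟩ := isCompact_Icc.exists_isMinOn
    (nonempty_Icc.2 (by linarith : a ≤ a + Real.pi)) hg.continuousOn
  set ε := g t / 2 with hε
  have hε0 : 0 < ε := half_pos (ha t ht)
  set φ := a + Real.pi / 2 with hφ
  set f : ℝ → ℝ := fun θ => g θ - ε * Real.cos (θ - φ) with hf
  have hfc : Continuous f := by fun_prop
  have hfper : Function.Periodic f (2 * Real.pi) := fun θ => by
    simp only [hf, hper θ, show θ + 2 * Real.pi - φ = θ - φ + 2 * Real.pi by ring,
      Real.cos_add_two_pi]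
  have hpos : ∀ θ ∈ Icc a (a + 2 * Real.pi), 0 < f θ := by
    intro θ hθ
    rcases le_total θ (a + Real.pi) with h | h
    · have h1 : g t ≤ g θ := hmin ⟨hθ.1, h⟩
      have h2 := Real.cos_le_one (θ - φ)
      simp only [hf]
      nlinarith
    -- On the complementary open half circle the cosine is negative, which helps; at its two
    -- endpoints the cosine is zero, but there `g` is positive because the given half circle is
    -- closed.
    · rcases eq_or_lt_of_le h with h | h
      · have h1 := ha (a + Real.pi) ⟨by linarith, le_rfl⟩
        have h2 : Real.cos (a + Real.pi - φ) = 0 := by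
          rw [hφ, show a + Real.pi - (a + Real.pi / 2) = Real.pi / 2 by ring, Real.cos_pi_div_two]
        simp only [hf, ← h, h2]
        linarith
      · rcases eq_or_lt_of_le hθ.2 with h' | h'
        · have h1 := ha a ⟨le_rfl, by linarith⟩
          have h2 : Real.cos (a - φ) = 0 := by
            rw [hφ, show a - (a + Real.pi / 2) = -(Real.pi / 2) by ring, Real.cos_neg,
              Real.cos_pi_div_two]
          rw [h', hfper]
          simp only [hf, h2]
          linarith
        · have h1 := Real.cos_neg_of_pi_div_two_lt_of_lt (x := θ - φ) (by linarith) (by linarith)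
          have h2 := hnn θ
          simp only [hf]
          nlinarith
  obtain ⟨s, hs, hsmin⟩ := isCompact_Icc.exists_isMinOn
    (nonempty_Icc.2 (by linarith : a ≤ a + 2 * Real.pi)) hfc.continuousOn
  refine ⟨ε • unitVec φ, f s, hpos s hs, fun θ => ?_⟩
  obtain ⟨θ', hθ', he⟩ := hfper.exists_mem_Ico Real.two_pi_pos θ a
  have h1 : f s ≤ f θ' := hsmin (Ico_subset_Icc_self hθ')
  rw [← he] at h1
  rw [inner_smul_left, inner_unitVec_unitVec]
  exact h1

theorem isLeast_circumradius (hK : IsCompact K) (hne : K.Nonempty) :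
    IsLeast {r : ℝ | 0 ≤ r ∧ ∃ x : Plane, K ⊆ Metric.closedBall x r} (circumradius K) := by
  obtain ⟨k, hk⟩ := hne
  obtain ⟨R, hR⟩ := hK.isBounded.subset_closedBall k
  have hR0 : 0 ≤ R := by simpa using hR hk
  -- Radii and centers are minimized over jointly; the cutoff by the known radius `R` makes the set
  -- compact.
  set C : Set (ℝ × Plane) := {q | 0 ≤ q.1 ∧ q.1 ≤ R ∧ ∀ y ∈ K, dist y q.2 ≤ q.1} with hC
  have hCc : IsCompact C := by
    refine (isCompact_Icc.prod (isCompact_closedBall k R)).of_isClosed_subset ?_ ?_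
      (s := Icc (0 : ℝ) R ×ˢ Metric.closedBall k R)
    · refine (isClosed_le continuous_const continuous_fst).inter
        ((isClosed_le continuous_fst continuous_const).inter ?_)
      have e : {q : ℝ × Plane | ∀ y ∈ K, dist y q.2 ≤ q.1} = ⋂ y ∈ K, {q | dist y q.2 ≤ q.1} := by
        ext
        simp
      exact (congrArg IsClosed e).mpr
        (isClosed_biInter fun y _ => isClosed_le (by fun_prop) continuous_fst)
    · rintro ⟨r, x⟩ ⟨h0, h1, h2⟩
      exact ⟨⟨h0, h1⟩, by rw [Metric.mem_closedBall, dist_comm]; exact (h2 k hk).trans h1⟩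
  obtain ⟨⟨r, x⟩, ⟨h0, h1, h2⟩, hmin⟩ := hCc.exists_isMinOn
    ⟨(R, k), hR0, le_rfl, fun y hy => hR hy⟩ continuous_fst.continuousOn
  have hleast : IsLeast {r : ℝ | 0 ≤ r ∧ ∃ x : Plane, K ⊆ Metric.closedBall x r} r := by
    refine ⟨⟨h0, x, fun y hy => h2 y hy⟩, ?_⟩
    rintro r' ⟨hr', x', hx'⟩
    rcases le_total r' R with h | h
    · exact hmin (show (r', x') ∈ C from ⟨hr', h, fun y hy => hx' hy⟩)
    · exact h1.trans h
  rwa [circumradius, hleast.csInf_eq]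

theorem isGreatest_inradius (hK : IsCompact K) (hc : Convex ℝ K) (hne : K.Nonempty) :
    IsGreatest {r : ℝ | 0 ≤ r ∧ ∃ x : Plane, Metric.closedBall x r ⊆ K} (inradius K) := by
  obtain ⟨k, hk⟩ := hne
  have hne : K.Nonempty := ⟨k, hk⟩
  obtain ⟨R, hR⟩ := (hK.image (f := fun x : Plane => suppFun K 0 - inner ℝ x (unitVec 0))
    (by fun_prop)).bddAbove
  set C : Set (ℝ × Plane) := {q | 0 ≤ q.1 ∧ q.2 ∈ K ∧
    ∀ θ, inner ℝ q.2 (unitVec θ) + q.1 ≤ suppFun K θ} with hC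
  have hmemC : ∀ r x, 0 ≤ r → Metric.closedBall x r ⊆ K → (r, x) ∈ C := fun r x hr h =>
    ⟨hr, h (Metric.mem_closedBall_self hr), (closedBall_subset_iff hK hc hne x hr).1 h⟩
  have hCc : IsCompact C := by
    refine (isCompact_Icc.prod hK).of_isClosed_subset ?_ ?_ (s := Icc (0 : ℝ) R ×ˢ K)
    · refine (isClosed_le continuous_const continuous_fst).inter
        ((hK.isClosed.preimage continuous_snd).inter ?_)
      have e : {q : ℝ × Plane | ∀ θ, inner ℝ q.2 (unitVec θ) + q.1 ≤ suppFun K θ} =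
          ⋂ θ, {q | inner ℝ q.2 (unitVec θ) + q.1 ≤ suppFun K θ} := by
        ext
        simp
      exact (congrArg IsClosed e).mpr
        (isClosed_iInter fun θ => isClosed_le (by fun_prop) continuous_const)
    · rintro ⟨r, x⟩ ⟨h0, h1, h2⟩
      have h3 := hR (mem_image_of_mem _ h1)
      have h4 := h2 0
      simp only at h3 h4
      exact ⟨⟨h0, by linarith⟩, h1⟩
  obtain ⟨⟨r, x⟩, ⟨h0, h1, h2⟩, hmax⟩ := hCc.exists_isMaxOn
    ⟨(0, k), hmemC 0 k le_rfl (by simpa using hk)⟩ continuous_fst.continuousOn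
  have hgreatest : IsGreatest {r : ℝ | 0 ≤ r ∧ ∃ x : Plane, Metric.closedBall x r ⊆ K} r := by
    refine ⟨⟨h0, x, (closedBall_subset_iff hK hc hne x h0).2 h2⟩, ?_⟩
    rintro r' ⟨hr', x', hx'⟩
    exact hmax (hmemC r' x' hr' hx')
  rwa [inradius, hgreatest.csSup_eq]

/-- The support function of `K` touches that of a minimal circumscribed disk in each closed half
circle. -/
theorem exists_diskGap_circumradius_eq_zero (hK : IsCompact K) (hint : (interior K).Nonempty)
    (hp : SmoothPeriodic (suppFun K)) {x : Plane}
    (hx : K ⊆ Metric.closedBall x (circumradius K)) (a : ℝ) :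
    ∃ θ ∈ Icc a (a + Real.pi), diskGap K x (circumradius K) θ = 0 := by
  have hne : K.Nonempty := hint.mono interior_subset
  have hf := smoothPeriodic_diskGap hp x (circumradius K)
  have hle : ∀ θ, diskGap K x (circumradius K) θ ≤ 0 := fun θ => by
    have := (subset_closedBall_iff hK hne x _).1 hx θ
    rw [diskGap]
    linarith
  by_contra! hcon
  obtain ⟨y, m, hm, hy⟩ := exists_pos_le_sub_inner (g := fun θ => -diskGap K x (circumradius K) θ)
    hf.continuous.neg (fun θ => by simp only [hf.periodic θ]) (fun θ => neg_nonneg.2 (hle θ))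
    (fun θ hθ => neg_pos.2 (lt_of_le_of_ne (hle θ) (hcon θ hθ)))
  have hsub : ∀ θ, suppFun K θ ≤ inner ℝ (x - y) (unitVec θ) + (circumradius K - m) := fun θ => by
    have := hy θ
    rw [diskGap] at this
    rw [inner_sub_left]
    linarith
  -- A competitor needs a nonnegative radius: in two opposite directions the center cancels, and the
  -- positive width is at most twice this radius.
  have hnn : 0 ≤ circumradius K - m := by
    have h1 := suppFun_add_suppFun_pi_pos hK hint 0
    have h2 := hsub 0
    have h3 := hsub (0 + Real.pi)
    rw [inner_unitVec_add_pi] at h3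
    linarith
  have := (isLeast_circumradius hK hne).2
    ⟨hnn, x - y, (subset_closedBall_iff hK hne _ _).2 hsub⟩
  linarith

/-- The support function of `K` touches that of a maximal inscribed disk in each closed half
circle. -/
theorem exists_diskGap_inradius_eq_zero (hK : IsCompact K) (hc : Convex ℝ K) (hne : K.Nonempty)
    (hp : SmoothPeriodic (suppFun K)) {x : Plane}
    (hx : Metric.closedBall x (inradius K) ⊆ K) (a : ℝ) :
    ∃ θ ∈ Icc a (a + Real.pi), diskGap K x (inradius K) θ = 0 := by
  have hf := smoothPeriodic_diskGap hp x (inradius K)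
  have hgr := isGreatest_inradius hK hc hne
  have hle : ∀ θ, 0 ≤ diskGap K x (inradius K) θ := fun θ => by
    have := (closedBall_subset_iff hK hc hne x hgr.1.1).1 hx θ
    rw [diskGap]
    linarith
  by_contra! hcon
  obtain ⟨y, m, hm, hy⟩ := exists_pos_le_sub_inner hf.continuous hf.periodic hle
    (fun θ hθ => lt_of_le_of_ne (hle θ) (hcon θ hθ).symm)
  have hsub : ∀ θ, inner ℝ (x + y) (unitVec θ) + (inradius K + m) ≤ suppFun K θ := fun θ => by
    have := hy θ
    rw [diskGap] at this
    rw [inner_add_left]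
    linarith
  have hnn : 0 ≤ inradius K + m := add_nonneg hgr.1.1 hm.le
  have := hgr.2 ⟨hnn, x + y, (closedBall_subset_iff hK hc hne _ hnn).2 hsub⟩
  linarith

theorem two_pi_mul_sq_le_of_zero_in_half_periods (hK : IsCompact K) (hne : K.Nonempty)
    (hp : SmoothPeriodic (suppFun K)) {x : Plane} {t : ℝ}
    (h : ∀ a, ∃ θ ∈ Icc a (a + Real.pi), diskGap K x t θ = 0) :
    2 * Real.pi * (perimeter K / (2 * Real.pi) - t) ^ 2 ≤
      energy (deriv (deviation K)) - energy (deviation K) := by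
  have h1 := integral_sq_le_of_zero_in_half_periods (smoothPeriodic_diskGap hp x t) h
  have h2 := energy_diskGap_sub hK hne hp x t
  simp only [energy] at h1 h2 ⊢
  linarith

theorem inradius_le_circumradius (hK : IsCompact K) (hc : Convex ℝ K) (hne : K.Nonempty) :
    inradius K ≤ circumradius K := by
  obtain ⟨h0, x, hx⟩ := (isLeast_circumradius hK hne).1
  obtain ⟨h0', y, hy⟩ := (isGreatest_inradius hK hc hne).1
  have h1 := fun θ => ((closedBall_subset_iff hK hc hne y h0').1 hy θ).trans
    ((subset_closedBall_iff hK hne x _).1 hx θ)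
  have h2 := h1 0
  have h3 := h1 (0 + Real.pi)
  rw [inner_unitVec_add_pi, inner_unitVec_add_pi] at h3
  linarith

/-- **Bonnesen's inequality**, with the isoperimetric deficit expressed by the energies of the
deviation. -/
theorem pi_mul_circumradius_sub_inradius_sq_le (hK : IsCompact K) (hc : Convex ℝ K)
    (hint : (interior K).Nonempty) (hp : SmoothPeriodic (suppFun K)) :
    Real.pi * (circumradius K - inradius K) ^ 2 ≤
      2 * (energy (deriv (deviation K)) - energy (deviation K)) := by
  have hne : K.Nonempty := hint.mono interior_subset
  obtain ⟨-, x, hx⟩ := (isLeast_circumradius hK hne).1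
  obtain ⟨-, y, hy⟩ := (isGreatest_inradius hK hc hne).1
  have h1 := two_pi_mul_sq_le_of_zero_in_half_periods hK hne hp
    (exists_diskGap_circumradius_eq_zero hK hint hp hx)
  have h2 := two_pi_mul_sq_le_of_zero_in_half_periods hK hne hp
    (exists_diskGap_inradius_eq_zero hK hc hne hp hy)
  set c := perimeter K / (2 * Real.pi)
  have h3 : (circumradius K - inradius K) ^ 2 ≤
      2 * (c - circumradius K) ^ 2 + 2 * (c - inradius K) ^ 2 := by
    nlinarith [sq_nonneg ((c - circumradius K) + (c - inradius K))]
  nlinarith [mul_le_mul_of_nonneg_left h3 Real.pi_pos.le]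

/-- Popoviciu's inequality for the curvature radius. -/
theorem two_mul_energy_le_rhoMax_sub_rhoMin_sq (hK : IsCompact K) (hne : K.Nonempty)
    (hp : SmoothPeriodic (suppFun K)) :
    2 * (energy (deviation K) - 2 * energy (deriv (deviation K))
      + energy (deriv (deriv (deviation K)))) ≤ Real.pi * (rhoMax K - rhoMin K) ^ 2 := by
  have hR := smoothPeriodic_supportRadius hp
  have hrho : rho K = supportRadius K := funext (rho_eq hK hne hp)
  have hcomp : IsCompact (range (supportRadius K)) := by
    have := hR.periodic.image_Icc Real.two_pi_pos 0
    rw [← this]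
    exact isCompact_Icc.image hR.continuous
  have hM : ∀ θ, supportRadius K θ ≤ rhoMax K := fun θ => by
    rw [rhoMax, hrho]
    exact le_csSup hcomp.bddAbove (mem_range_self θ)
  have hm : ∀ θ, rhoMin K ≤ supportRadius K θ := fun θ => by
    rw [rhoMin, hrho]
    exact csInf_le hcomp.bddBelow (mem_range_self θ)
  -- About the midpoint of its range the curvature radius deviates by at most half the spread.
  have h1 := energy_supportRadius_sub_const hK hne hp ((rhoMax K + rhoMin K) / 2)
  have h2 : energy (fun θ => supportRadius K θ - (rhoMax K + rhoMin K) / 2) ≤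
      ∫ _ in (0 : ℝ)..(2 * Real.pi), ((rhoMax K - rhoMin K) / 2) ^ 2 := by
    refine intervalIntegral.integral_mono_on Real.two_pi_pos.le ?_
      (SmoothPeriodic.const _).intervalIntegrable fun θ _ => ?_
    · exact ((hR.sub (SmoothPeriodic.const _)).continuous.pow 2).intervalIntegrable _ _
    · refine sq_le_sq' ?_ ?_
      · linarith [hm θ]
      · linarith [hM θ]
  rw [intervalIntegral.integral_const, smul_eq_mul] at h2
  nlinarith [mul_nonneg Real.two_pi_pos.le
    (sq_nonneg (perimeter K / (2 * Real.pi) - (rhoMax K + rhoMin K) / 2))]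

end bonnesen

/-! ### Disks -/

section disks

variable {K : Set Plane}

theorem isDisk_of_energy_deviation_eq_zero (hK : IsSmoothStrictlyConvexDomain K)
    (h : energy (deviation K) = 0) : IsDisk K := by
  have hp := smoothPeriodic_suppFun hK
  have hne : K.Nonempty := hK.interior_nonempty.mono interior_subset
  have h0 := (smoothPeriodic_deviation hp).eq_zero_of_integral_sq h
  have hpos : 0 < perimeter K / (2 * Real.pi) :=
    div_pos (perimeter_pos hK.isCompact hK.interior_nonempty hp) Real.two_pi_pos
  refine ⟨steinerPoint K, perimeter K / (2 * Real.pi), hpos, Subset.antisymm ?_ ?_⟩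
  · refine (subset_closedBall_iff hK.isCompact hne _ _).2 fun θ => ?_
    have := h0 θ
    rw [deviation, diskGap] at this
    linarith
  · refine (closedBall_subset_iff hK.isCompact hK.strictConvex.convex hne _ hpos.le).2 fun θ => ?_
    have := h0 θ
    rw [deviation, diskGap] at this
    linarith

theorem deviation_closedBall (x : Plane) {r : ℝ} (hr : 0 ≤ r) :
    deviation (Metric.closedBall x r) = fun _ => 0 := by
  set K := Metric.closedBall x r
  have hs : suppFun K = fun θ => inner ℝ x (unitVec θ) + r := funext (suppFun_closedBall x hr)
  have hl := smoothPeriodic_inner_unitVec x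
  have hp : SmoothPeriodic (suppFun K) := by
    rw [hs]
    exact hl.add (SmoothPeriodic.const r)
  have hL : perimeter K = 2 * Real.pi * r := by
    rw [perimeter_eq (isCompact_closedBall x r) (Metric.nonempty_closedBall.2 hr) hp, hs,
      intervalIntegral.integral_add hl.intervalIntegrable
        (SmoothPeriodic.const r).intervalIntegrable, integral_inner_unitVec,
      intervalIntegral.integral_const]
    simp
  have hx : steinerPoint K = x := by
    have hpi := Real.pi_ne_zero
    have hc : ∫ θ in (0 : ℝ)..(2 * Real.pi), suppFun K θ * Real.cos θ = Real.pi * x 0 := by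
      simp only [hs, add_mul]
      rw [intervalIntegral.integral_add (hl.mul SmoothPeriodic.cos).intervalIntegrable
        (SmoothPeriodic.cos.const_mul r).intervalIntegrable, integral_inner_unitVec_mul_cos,
        intervalIntegral.integral_const_mul, integral_cos]
      simp
    have hsn : ∫ θ in (0 : ℝ)..(2 * Real.pi), suppFun K θ * Real.sin θ = Real.pi * x 1 := by
      simp only [hs, add_mul]
      rw [intervalIntegral.integral_add (hl.mul SmoothPeriodic.sin).intervalIntegrable
        (SmoothPeriodic.sin.const_mul r).intervalIntegrable, integral_inner_unitVec_mul_sin,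
        intervalIntegral.integral_const_mul, integral_sin]
      simp
    ext i
    fin_cases i
    · simp [steinerPoint, hc, hpi]
    · simp [steinerPoint, hsn, hpi]
  have hpi := Real.pi_ne_zero
  funext θ
  rw [deviation, diskGap, hx, hL, hs]
  field_simp
  ring

/-- If the deviation satisfies `r'' = -4 r`, then the annulus around the Steiner point gives a
bound that is better than Bonnesen's inequality. -/
theorem pi_mul_circumradius_sub_inradius_sq_le_of_deriv_deriv_eq
    (hK : IsSmoothStrictlyConvexDomain K)
    (h : ∀ θ, deriv (deriv (deviation K)) θ = -4 * deviation K θ)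
    (hE : energy (deriv (deviation K)) = 4 * energy (deviation K)) :
    Real.pi * (circumradius K - inradius K) ^ 2 ≤ 4 * energy (deviation K) := by
  have hp := smoothPeriodic_suppFun hK
  have hne : K.Nonempty := hK.interior_nonempty.mono interior_subset
  have hc := hK.strictConvex.convex
  have hr := smoothPeriodic_deviation hp
  have hpi := Real.pi_pos
  set r := deviation K with hrdef
  -- The conserved energy of the oscillator `r'' = -4r`: being constant, it equals its mean, which
  -- gives the pointwise bound `π r² ≤ ‖r‖²`.
  set m : ℝ → ℝ := fun θ => deriv r θ ^ 2 + 4 * r θ ^ 2 with hm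
  have hmd : ∀ θ, HasDerivAt m 0 θ := by
    intro θ
    refine (((hr.deriv.hasDerivAt θ).fun_pow 2).add
      (((hr.hasDerivAt θ).fun_pow 2).const_mul 4)).congr_deriv ?_
    rw [h]
    push_cast
    ring
  have hconst : ∀ θ φ, m θ = m φ :=
    is_const_of_deriv_eq_zero (fun θ => (hmd θ).differentiableAt) fun θ => (hmd θ).deriv
  have hint : ∫ θ in (0 : ℝ)..(2 * Real.pi), m θ = 8 * energy r := by
    simp only [energy, hm, sq] at hE ⊢
    rw [intervalIntegral.integral_add (hr.deriv.mul hr.deriv).intervalIntegrable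
      ((hr.mul hr).const_mul 4).intervalIntegrable, intervalIntegral.integral_const_mul]
    linarith
  have hbound : ∀ θ, Real.pi * r θ ^ 2 ≤ energy r := by
    intro θ
    have h1 : ∫ φ in (0 : ℝ)..(2 * Real.pi), m φ = 2 * Real.pi * m θ := by
      simp_rw [fun φ => hconst φ θ]
      rw [intervalIntegral.integral_const]
      simp
    rw [hint] at h1
    have h2 : 4 * r θ ^ 2 ≤ m θ := le_add_of_nonneg_left (sq_nonneg _)
    nlinarith
  set e := Real.sqrt (energy r / Real.pi) with he
  have he2 : e ^ 2 = energy r / Real.pi := Real.sq_sqrt (div_nonneg (energy_nonneg r) hpi.le)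
  have habs : ∀ θ, |r θ| ≤ e := fun θ => by
    refine Real.abs_le_sqrt ?_
    rw [le_div_iff₀ hpi, mul_comm]
    exact hbound θ
  have he0 : 0 ≤ e := Real.sqrt_nonneg _
  set c := perimeter K / (2 * Real.pi) with hcdef
  have hcpos : 0 ≤ c :=
    (div_pos (perimeter_pos hK.isCompact hK.interior_nonempty hp) Real.two_pi_pos).le
  have hcirc : circumradius K ≤ c + e := by
    refine (isLeast_circumradius hK.isCompact hne).2 ⟨add_nonneg hcpos he0, steinerPoint K, ?_⟩
    refine (subset_closedBall_iff hK.isCompact hne _ _).2 fun θ => ?_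
    have h1 := (abs_le.1 (habs θ)).2
    rw [hrdef, deviation, diskGap] at h1
    linarith
  have hin : c - e ≤ inradius K := by
    have hgr := isGreatest_inradius hK.isCompact hc hne
    -- If the inner circle of the annulus degenerates, nonnegativity of the inradius suffices.
    rcases le_total (c - e) 0 with h0 | h0
    · exact h0.trans hgr.1.1
    · refine hgr.2 ⟨h0, steinerPoint K, ?_⟩
      refine (closedBall_subset_iff hK.isCompact hc hne _ h0).2 fun θ => ?_
      have h1 := (abs_le.1 (habs θ)).1
      rw [hrdef, deviation, diskGap] at h1
      linarith
  have hle := inradius_le_circumradius hK.isCompact hc hne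
  have h1 : (circumradius K - inradius K) ^ 2 ≤ (2 * e) ^ 2 :=
    pow_le_pow_left₀ (sub_nonneg.2 hle) (by linarith) 2
  rw [mul_pow, he2, ← mul_div_assoc, le_div_iff₀ hpi] at h1
  linarith

end disks

/-! ### The stability inequality -/

section stability

variable {K : Set Plane}

/-- The functional `W` as the sum of `3D/(2π) ‖r‖²`, where `r` is the deviation, and of terms that
are nonnegative under the stability condition. -/
theorem W_eq (hK : IsSmoothStrictlyConvexDomain K) (α δ μ σ η lam ξ ζ : ℝ)
    (hcb : energy (deriv (deviation K)) ≤ energy (deriv (deriv (deviation K)))) :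
    W K α δ μ σ η lam ξ ζ =
      3 * stabNumber α μ σ η lam ξ ζ / (2 * Real.pi) * energy (deviation K)
      + Real.pi * (perimeter K / (2 * Real.pi)) ^ 2
        * (2 * α + 4 * Real.pi * δ + μ - 4 * ζ + 4 * ζ)
      + ((2 * α + σ - 2 * η - 4 * ζ) / 2 + 2 * ζ) * (energy (deriv (deriv (deviation K)))
        - 5 * energy (deriv (deviation K)) + 4 * energy (deviation K))
      + η * (energy (deriv (deriv (deriv (deviation K)))) - energy (deriv (deriv (deviation K)))
        - 16 * energy (deriv (deviation K)) + 16 * energy (deviation K))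
      + stabNumber α μ σ η lam ξ ζ / (2 * Real.pi) *
        (energy (deriv (deviation K)) - 4 * energy (deviation K))
      + lam * ((circumradius K - inradius K) ^ 2
        - 2 / Real.pi * (energy (deriv (deviation K)) - energy (deviation K)))
      + ξ * ((rhoMax K - rhoMin K) ^ 2
        - 2 / Real.pi * (energy (deriv (deviation K)) - energy (deviation K)))
      + ζ * (6 * (energy (deriv (deviation K)) - energy (deviation K)) + curvatureEnergy K) := by
  have hp := smoothPeriodic_suppFun hK
  have hne : K.Nonempty := hK.interior_nonempty.mono interior_subset
  have hpi := Real.pi_ne_zero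
  have hL : perimeter K = 2 * Real.pi * (perimeter K / (2 * Real.pi)) := by field_simp
  -- The hypothesis `hcb` makes the oriented area of the evolute nonpositive, so its absolute value
  -- is linear in the energies.
  have habs : |evoluteArea K| =
      1 / 2 * (energy (deriv (deriv (deviation K))) - energy (deriv (deviation K))) := by
    rw [evoluteArea_eq_energy hK.isCompact hne hp, abs_of_nonpos (by linarith)]
    ring
  rw [W, integral_rho_sq hK.isCompact hne hp, integral_rhoEvolute_sq hK.isCompact hne hp,
    area_eq_energy hK, habs]
  generalize hc : perimeter K / (2 * Real.pi) = c at hL ⊢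
  rw [hL, stabNumber]
  field_simp
  ring

theorem four_mul_energy_deviation_le (hK : IsSmoothStrictlyConvexDomain K) :
    4 * energy (deviation K) ≤ energy (deriv (deviation K)) := by
  have hp := smoothPeriodic_suppFun hK
  exact four_mul_integral_sq_le (smoothPeriodic_deviation hp)
    (integral_deviation hK.isCompact (hK.interior_nonempty.mono interior_subset) hp)
    (integral_deviation_mul_cos hp) (integral_deviation_mul_sin hp)

/-- It is `‖r'' + 4r‖²` plus three times the Wirtinger deficit `‖r'‖² - 4‖r‖²`. -/
theorem energy_second_order_nonneg (hK : IsSmoothStrictlyConvexDomain K) :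
    0 ≤ energy (deriv (deriv (deviation K))) - 5 * energy (deriv (deviation K))
      + 4 * energy (deviation K) := by
  have h1 := four_mul_energy_deviation_le hK
  have h2 := (smoothPeriodic_deviation (smoothPeriodic_suppFun hK)).energy_deriv_deriv_add 4
  have h3 := energy_nonneg (fun θ => deriv (deriv (deviation K)) θ + 4 * deviation K θ)
  linarith

/-- It is `‖r''' + 4r'‖²` plus seven times the second order form plus three times the Wirtinger
deficit. -/
theorem energy_third_order_nonneg (hK : IsSmoothStrictlyConvexDomain K) :
    0 ≤ energy (deriv (deriv (deriv (deviation K)))) - energy (deriv (deriv (deviation K)))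
      - 16 * energy (deriv (deviation K)) + 16 * energy (deviation K) := by
  have h1 := four_mul_energy_deviation_le hK
  have h2 :=
    (smoothPeriodic_deviation (smoothPeriodic_suppFun hK)).deriv.energy_deriv_deriv_add 4
  have h3 := energy_nonneg
    (fun θ => deriv (deriv (deriv (deviation K))) θ + 4 * deriv (deviation K) θ)
  have h4 := energy_second_order_nonneg hK
  linarith

theorem circumradius_sub_inradius_sq_le (hK : IsSmoothStrictlyConvexDomain K) :
    (circumradius K - inradius K) ^ 2 ≤
      2 / Real.pi * (energy (deriv (deviation K)) - energy (deviation K)) := by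
  have h := pi_mul_circumradius_sub_inradius_sq_le hK.isCompact hK.strictConvex.convex
    hK.interior_nonempty (smoothPeriodic_suppFun hK)
  rw [div_mul_eq_mul_div, le_div_iff₀ Real.pi_pos]
  linarith

theorem le_rhoMax_sub_rhoMin_sq (hK : IsSmoothStrictlyConvexDomain K) :
    2 / Real.pi * (3 * (energy (deriv (deviation K)) - energy (deviation K))) ≤
      (rhoMax K - rhoMin K) ^ 2 := by
  have h := two_mul_energy_le_rhoMax_sub_rhoMin_sq hK.isCompact
    (hK.interior_nonempty.mono interior_subset) (smoothPeriodic_suppFun hK)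
  have h2 := energy_second_order_nonneg hK
  rw [div_mul_eq_mul_div, div_le_iff₀ Real.pi_pos]
  linarith

/-- The lower bound for `W`, with those nonnegative terms that decide the equality case. -/
theorem le_W {α δ μ σ η lam ξ ζ : ℝ} (hK : IsSmoothStrictlyConvexDomain K)
    (hS : StabCondition α δ μ σ η lam ξ ζ) :
    3 * stabNumber α μ σ η lam ξ ζ / (2 * Real.pi) * energy (deviation K)
      + 4 * Real.pi * (perimeter K / (2 * Real.pi)) ^ 2 * ζ
      + stabNumber α μ σ η lam ξ ζ / (2 * Real.pi) *
        (energy (deriv (deviation K)) - 4 * energy (deviation K))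
      + -lam * (2 / Real.pi * (energy (deriv (deviation K)) - energy (deviation K))
        - (circumradius K - inradius K) ^ 2)
      + ξ * (4 / Real.pi * (energy (deriv (deviation K)) - energy (deviation K))) ≤
      W K α δ μ σ η lam ξ ζ := by
  have hpi := Real.pi_pos
  have ha := energy_nonneg (deviation K)
  have h1 := four_mul_energy_deviation_le hK
  have h2 := energy_second_order_nonneg hK
  have h3 := energy_third_order_nonneg hK
  -- This bound is three times what `W_eq` subtracts, so a multiple `4/π` of `‖r'‖² - ‖r‖²`
  -- survives; it settles the equality case for `ξ > 0`.
  have hξ := mul_le_mul_of_nonneg_left (le_rhoMax_sub_rhoMin_sq hK) hS.xi_nonneg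
  have hE := curvatureEnergy_nonneg K
  have t1 := mul_nonneg (mul_nonneg hpi.le (sq_nonneg (perimeter K / (2 * Real.pi)))) hS.first
  have t2 := mul_nonneg (add_nonneg (div_nonneg hS.second zero_le_two)
    (mul_nonneg zero_le_two hS.zeta_nonneg)) h2
  have t3 := mul_nonneg hS.eta_nonneg h3
  have t4 : 0 ≤ ζ * (6 * (energy (deriv (deviation K)) - energy (deviation K))
      + curvatureEnergy K) := mul_nonneg hS.zeta_nonneg (by linarith)
  rw [W_eq hK α δ μ σ η lam ξ ζ (by linarith)]
  have e : 4 / Real.pi = 2 * (2 / Real.pi) := by ring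
  rw [e]
  linarith

end stability

end SteinerStability

end

/-! ### The stability theorem and its equality cases -/

theorem theorem1p3 (K : Set SteinerStability.Plane)
    (hK : SteinerStability.IsSmoothStrictlyConvexDomain K)
    (α δ μ σ η lam ξ ζ : ℝ) :
    (SteinerStability.StabCondition α δ μ σ η lam ξ ζ →
      SteinerStability.h2 K (SteinerStability.steinerDisk K) ^ 2 ≤
        SteinerStability.stabConst α μ σ η lam ξ ζ *
          SteinerStability.W K α δ μ σ η lam ξ ζ) ∧
    (SteinerStability.stabNumber α μ σ η lam ξ ζ ≠ 0 →
      2 * α + 4 * Real.pi * δ + μ = 0 → ζ = 0 → SteinerStability.IsDisk K →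
      SteinerStability.h2 K (SteinerStability.steinerDisk K) ^ 2 =
        SteinerStability.stabConst α μ σ η lam ξ ζ *
          SteinerStability.W K α δ μ σ η lam ξ ζ) ∧
    (SteinerStability.StabCondition α δ μ σ η lam ξ ζ → 0 < lam ^ 2 + ξ ^ 2 + ζ ^ 2 →
      SteinerStability.h2 K (SteinerStability.steinerDisk K) ^ 2 =
        SteinerStability.stabConst α μ σ η lam ξ ζ *
          SteinerStability.W K α δ μ σ η lam ξ ζ →
      SteinerStability.IsDisk K) := by
  open SteinerStability in
  have hp := smoothPeriodic_suppFun hK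
  have hne : K.Nonempty := hK.interior_nonempty.mono interior_subset
  have hL := perimeter_pos hK.isCompact hK.interior_nonempty hp
  have ha := energy_nonneg (deviation K)
  have h4 := four_mul_energy_deviation_le hK
  have hB := circumradius_sub_inradius_sq_le hK
  rw [h2_steinerDisk_sq hL.le]
  have hscale : ∀ D w : ℝ, 2 * Real.pi / (3 * D) * w = w / (3 * D / (2 * Real.pi)) :=
    fun D w => by
      rw [div_div_eq_mul_div]
      ring
  refine ⟨fun hS => ?_, fun hD hfirst hζ hdisk => ?_, fun hS hpos heq => ?_⟩
  · have hle := le_W hK hS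
    have hD := hS.third
    have hb : 0 ≤ energy (deriv (deviation K)) - energy (deviation K) := by linarith
    have t1 : 0 ≤ 4 * Real.pi * (perimeter K / (2 * Real.pi)) ^ 2 * ζ :=
      mul_nonneg (by positivity) hS.zeta_nonneg
    have t2 : 0 ≤ stabNumber α μ σ η lam ξ ζ / (2 * Real.pi) *
        (energy (deriv (deviation K)) - 4 * energy (deviation K)) :=
      mul_nonneg (by positivity) (by linarith)
    have t3 := mul_nonneg (neg_nonneg.2 hS.lam_nonpos) (sub_nonneg.2 hB)
    have t4 := mul_nonneg hS.xi_nonneg (mul_nonneg (by positivity : 0 ≤ 4 / Real.pi) hb)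
    rw [stabConst, hscale, le_div_iff₀ (by positivity), mul_comm]
    linarith
  · obtain ⟨x, r, hr, rfl⟩ := hdisk
    have hdev := deviation_closedBall x hr.le
    have hR : rho (Metric.closedBall x r) =
        fun _ => perimeter (Metric.closedBall x r) / (2 * Real.pi) := by
      funext θ
      rw [rho_eq hK.isCompact hne hp, supportRadius_eq hp, hdev]
      simp
    have he0 : energy (fun _ => 0) = 0 := by simp [energy]
    have hd0 : deriv (fun _ : ℝ => (0 : ℝ)) = fun _ => 0 := funext fun θ => deriv_const θ 0
    rw [hdev, hd0, he0] at hB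
    have hB0 : (circumradius (Metric.closedBall x r) - inradius (Metric.closedBall x r)) ^ 2 = 0 :=
      le_antisymm (by simpa using hB) (sq_nonneg _)
    have hrho : rhoMax (Metric.closedBall x r) - rhoMin (Metric.closedBall x r) = 0 := by
      rw [rhoMax, rhoMin, hR, Set.range_const, csSup_singleton, csInf_singleton, sub_self]
    -- For a disk only the perimeter term and the curvature energy need not vanish by themselves;
    -- the two relations on the parameters remove them.
    rw [W_eq hK α δ μ σ η lam ξ ζ (by rw [hdev, hd0, hd0]), hdev, hd0, hd0, hd0, he0, hB0, hrho,
      hζ, hfirst]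
    simp
  · have hle := le_W hK hS
    have hD := hS.third
    rw [stabConst, hscale, eq_div_iff (by positivity), mul_comm] at heq
    have hb : 0 ≤ energy (deriv (deviation K)) - energy (deviation K) := by linarith
    have t1 : 0 ≤ 4 * Real.pi * (perimeter K / (2 * Real.pi)) ^ 2 * ζ :=
      mul_nonneg (by positivity) hS.zeta_nonneg
    have hDpos : 0 < stabNumber α μ σ η lam ξ ζ / (2 * Real.pi) := by positivity
    have t2 : 0 ≤ stabNumber α μ σ η lam ξ ζ / (2 * Real.pi) *
        (energy (deriv (deviation K)) - 4 * energy (deviation K)) :=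
      mul_nonneg hDpos.le (by linarith)
    have t3 := mul_nonneg (neg_nonneg.2 hS.lam_nonpos) (sub_nonneg.2 hB)
    have t4 := mul_nonneg hS.xi_nonneg (mul_nonneg (by positivity : 0 ≤ 4 / Real.pi) hb)
    have hE : energy (deriv (deviation K)) = 4 * energy (deviation K) := by
      have h0 : stabNumber α μ σ η lam ξ ζ / (2 * Real.pi) *
        (energy (deriv (deviation K)) - 4 * energy (deviation K)) = 0 := by linarith
      linarith [(mul_eq_zero.1 h0).resolve_left hDpos.ne']
    refine isDisk_of_energy_deviation_eq_zero hK ?_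
    -- For `ζ > 0` equality is contradictory, because the perimeter is positive.
    rcases hS.zeta_nonneg.lt_or_eq with hζ | hζ
    · have : 0 < 4 * Real.pi * (perimeter K / (2 * Real.pi)) ^ 2 * ζ := by positivity
      linarith
    rcases hS.xi_nonneg.lt_or_eq with hξ | hξ
    · have h0 : ξ * (4 / Real.pi * (energy (deriv (deviation K)) - energy (deviation K))) = 0 := by
        linarith
      have h1 := (mul_eq_zero.1 ((mul_eq_zero.1 h0).resolve_left hξ.ne')).resolve_left
        (by positivity)
      linarith
    have hlam : lam ≠ 0 := by
      rintro rfl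
      rw [← hζ, ← hξ] at hpos
      norm_num at hpos
    have h0 : -lam * (2 / Real.pi * (energy (deriv (deviation K)) - energy (deviation K))
        - (circumradius K - inradius K) ^ 2) = 0 := by linarith
    have h1 := (mul_eq_zero.1 h0).resolve_left (neg_ne_zero.2 hlam)
    have hdd := deriv_deriv_eq_of_four_mul_integral_sq_eq (smoothPeriodic_deviation hp)
      (integral_deviation hK.isCompact hne hp) (integral_deviation_mul_cos hp)
      (integral_deviation_mul_sin hp) hE.symm
    have h2 := pi_mul_circumradius_sub_inradius_sq_le_of_deriv_deriv_eq hK hdd hE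
    -- Equality in Bonnesen's inequality with `b = 4a` gives `6a`, whereas the annulus bound `h2`
    -- allows at most `4a`.
    have h3 : Real.pi * (circumradius K - inradius K) ^ 2 = 6 * energy (deviation K) := by
      rw [← sub_eq_zero.1 h1, hE]
      field_simp
      ring
    linarith
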